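/- **Setting.** For each $k\in\mathbb N$ let $G_k$ be a finite connected graph with a reversible random walk, i.e. a stochastic matrix $P$ that is reversible with respect to its stationary distribution $\pi$ and satisfies, for $x\ne y$, $P(x,y)>0$ iff $x\sim y$. (For instance, the lazy simple random walk.) The walks are uniformly lazy: there is $\alpha>0$ with $P(x,x)\ge\alpha$ for all $x$ and all $k$. The dependence on $k$ is often suppressed. Write $P_x,\mathbb E_x,\mathrm{Var}_x$ for the law, mean and variance for the walk $(x_t)$ started at $x$, and $\tau_U=\inf\{t\ge 0:x_t\in U\}$. *Geometry.* $G_k$ is made of a set $T_0$ and a set $\Sigma$ (the spine) with $T_0\cap\Sigma=\{0\}$ for a vertex $0$, and of finitely many (possibly no) branches $T_1,\dots,T_m$ disjoint from $T_0$ with $T_i\cap\Sigma=\{n_i\}$; these sets cover the graph, different branches meet at most in the spine, and $T_0$ (resp. $T_i$) can be left only through $0$ (resp. $n_i$). The *edge* of a set as seen from a point is the set of its points at maximal graph distance from that point; $\partial D$ is the edge of $T_0$ as seen from $0$, $\partial T_i$ that of $T_i$ as seen from $n_i$, and $c$ is a point of the edge of $\Sigma$ as seen from $0$. There is an integer $z$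 with $0<z<\mathrm{dist}(0,c)$ and $\mathrm{dist}(0,n_i)\ge z$ for all $i$; the bottleneck is $B[0,z]=\{x\in\Sigma:\mathrm{dist}(0,x)\le z\}$, its end (also denoted $z$) is $\{x\in\Sigma:\mathrm{dist}(0,x)=z\}$, $D=T_0\cup B[0,z]$ and $S=D^c$. (No branches: two graphs joined by a bottleneck. $\Sigma$ a line: a line with graphs $T_i$ attached to it.) $T_0$ and $\Sigma$ are radially symmetric around $0$, and each $T_i$ around $n_i$, where $U$ is *radially symmetric around* $o$ if the walk is lumpable with respect to some equivalence relation on the vertices (the probability of jumping into a class depends only on the class of the present position) for which $\{o\}$ is a class and any two points of $U$ at the same distance from $o$ are equivalent. Hence $\mathbb E_{\partial D}(\tau_0)$, $\mathrm{Var}_{\partial D}(\tau_0)$ and $\mathbb E_{\partial T_i}(\tau_{n_i})$ do not depend on the starting point chosen in $\partial D$, $\partial T_i$. *Excursions.* For the walk started at $0$ let $L$ be the number of times $1\le s\le\tau_z$ with $x_{s-1}\notin T_0$, $x_s\in T_0$. Let $\mathbb E[\theta]$ be the mean length of an excursion from $0$ (up to the return to $0$) whose first step goes into $B[0,z]\setminus\{0\}$,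 conditioned to return to $0$ before hitting $z$; let $\mathbb E[\lambda]$ be the mean length of an excursion from $0$ whose first step goes into $T_0\setminus\{0\}$, conditioned to return to $0$ before hitting $\partial D$. (A mean conditioned on a null event is read as $0$.) *Mixing.* $t_{mix}(\epsilon)=\min\{t\ge0:\max_x\|P^t(x,\cdot)-\pi\|\le\epsilon\}$ with $\|\mu-\nu\|=\sup_A|\mu(A)-\nu(A)|$. For real sequences, $a_k\prec b_k$ means $a_k=o(b_k)$ as $k\to\infty$. **Proposition.** Let $A_k\in(0,1]$, $\gamma_k\to\infty$ and $\delta_k>0$. Assume - (C1) $\pi(B[0,z]\cup S)\to0$ as $k\to\infty$; - (C2) there is a nondecreasing $h:\mathbb N\to(0,\infty)$, not depending on $k$, with $P(L\le z)\le 1/h(z)$ for every $k$; - (C3) $\mathbb E_0(\tau_{\partial D})\le\mathbb E_{\partial D}(\tau_0)$ and $\mathbb E_{\partial T_i}(\tau_{n_i})\le\mathbb E_{\partial D}(\tau_0)$ for every $i$ and every $k$; - (H)(a) $\gamma\sqrt{\mathrm{Var}_c(\tau_0)}\prec\mathbb E_c(\tau_0)$, and (H)(b) $\mathbb E_{\partial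 D}(\tau_0)+\mathbb E[L]\,\big(\mathbb E[\lambda]+\mathbb E[\theta]\big)\prec\dfrac{\gamma\sqrt{\mathrm{Var}_c(\tau_0)}}{A}$; - (H2) $\dfrac{\mathbb E_c(\tau_0)+\frac\gamma2\sqrt{\mathrm{Var}_c(\tau_0)}}{A}\ge\mathbb E_{\partial D}(\tau_0)+\delta\sqrt{\mathrm{Var}_{\partial D}(\tau_0)}$ for every $k$. Then for every $0<\epsilon<1$ and all sufficiently large $k$ (the minimum defining $t_{mix}(\epsilon)$ exists and) $$t_{mix}(\epsilon)\le\frac{\mathbb E_c(\tau_0)+\gamma\sqrt{\mathrm{Var}_c(\tau_0)}}{A}.$$ -/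

import Mathlib

open Filter Topology MeasureTheory ProbabilityTheory Asymptotics

noncomputable section

/-- A reversible nearest-neighbour random walk on the graph `G`, with transition matrix `P` and
stationary distribution `stat`; holding (staying put) is allowed.  Simple random walk, lazy simple
random walk and random walks with edge weights are all of this kind. -/
structure GraphWalk {V : Type*} [Fintype V] (G : SimpleGraph V) where
  P : Matrix V V ℝ
  nonneg : ∀ x y, 0 ≤ P x y
  row_sum : ∀ x, ∑ y, P x y = 1
  pos_iff_adj : ∀ x y, x ≠ y → (0 < P x y ↔ G.Adj x y)
  stat : V → ℝ
  stat_nonneg : ∀ x, 0 ≤ stat x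
  stat_sum : ∑ x, stat x = 1
  reversible : ∀ x y, stat x * P x y = stat y * P y x

/-! ### Total variation and mixing time -/

/-- Total variation distance `sup_A |μ(A) - ν(A)|` of two distributions on a finite set. -/
def tvDist {V : Type*} (μ ν : V → ℝ) : ℝ :=
  ⨆ A : Finset V, |∑ x ∈ A, μ x - ∑ x ∈ A, ν x|

/-- The times `t` at which `max_x ‖P^t(x, ·) - π‖ ≤ ε`. -/
def mixedTimes {V : Type*} [Fintype V] [DecidableEq V] {G : SimpleGraph V} (W : GraphWalk G)
    (ε : ℝ) : Set ℕ :=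
  {t | ⨆ x : V, tvDist ((W.P ^ t) x) W.stat ≤ ε}

/-- The mixing time `t_mix(ε) = min {t ≥ 0 : max_x ‖P^t(x, ·) - π‖ ≤ ε}`. -/
def tmix {V : Type*} [Fintype V] [DecidableEq V] {G : SimpleGraph V} (W : GraphWalk G)
    (ε : ℝ) : ℕ :=
  sInf (mixedTimes W ε)

/-! ### The law of the walk on path space -/

section Law

variable {V : Type*} [Fintype V] [MeasurableSpace V] [DiscreteMeasurableSpace V]
  {G : SimpleGraph V}

/-- The one-step transition kernel of the walk. -/
def stepKernel (W : GraphWalk G) : Kernel V V where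
  toFun x := ∑ y, ENNReal.ofReal (W.P x y) • Measure.dirac y
  measurable' := Measurable.of_discrete

instance (W : GraphWalk G) : IsMarkovKernel (stepKernel W) where
  isProbabilityMeasure x := by
    constructor
    change (∑ y, ENNReal.ofReal (W.P x y) • Measure.dirac y : Measure V) Set.univ = 1
    simp only [Measure.coe_finsetSum, Finset.sum_apply, Measure.smul_apply, measure_univ,
      smul_eq_mul, mul_one]
    rw [← ENNReal.ofReal_sum_of_nonneg (fun y _ => W.nonneg x y), W.row_sum, ENNReal.ofReal_one]

/-- The same kernel, seen as giving the next position from the history up to time `n`. -/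
def historyKernel (W : GraphWalk G) (n : ℕ) : Kernel (Finset.Iic n → V) V :=
  (stepKernel W).comap (fun w => w ⟨n, Finset.mem_Iic.2 le_rfl⟩) (measurable_pi_apply _)

instance (W : GraphWalk G) (n : ℕ) : IsMarkovKernel (historyKernel W n) := by
  unfold historyKernel; infer_instance

/-- The law `P_x` of the trajectory of the walk started at `x`. -/
def pathLaw (W : GraphWalk G) (x : V) : Measure (ℕ → V) :=
  Kernel.traj (X := fun _ => V) (historyKernel W) 0 (fun _ => x)

end Law

/-- `inf {s ≥ m : x_s ∈ U}`, equal to `⊤` when there is no such `s`. -/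
def hitFrom {V : Type*} (m : ℕ∞) (U : Set V) (w : ℕ → V) : ℕ∞ :=
  sInf {t : ℕ∞ | ∃ s : ℕ, t = s ∧ m ≤ s ∧ w s ∈ U}

/-- `τ_U = inf {s : x_s ∈ U}`. -/
def hit {V : Type*} (U : Set V) (w : ℕ → V) : ℕ∞ := hitFrom 0 U w

section Moments

variable {V : Type*} [Fintype V] [MeasurableSpace V] [DiscreteMeasurableSpace V]
  {G : SimpleGraph V}

/-- `E_x(τ_U)`. -/
def meanHit (W : GraphWalk G) (x : V) (U : Set V) : ℝ :=
  ∫ w, ((hit U w).toNat : ℝ) ∂(pathLaw W x)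

/-- `√Var_x(τ_U)`. -/
def sdHit (W : GraphWalk G) (x : V) (U : Set V) : ℝ :=
  √(variance (fun w => ((hit U w).toNat : ℝ)) (pathLaw W x))

end Moments

/-! ### The geometry -/

/-- The edge of `U` as seen from `o`: the points of `U` that are furthest from `o`. -/
def edgeOf {V : Type*} (G : SimpleGraph V) (o : V) (U : Set V) : Set V :=
  {x | x ∈ U ∧ ∀ y ∈ U, G.dist o y ≤ G.dist o x}

open Classical in
/-- The walk is lumpable with respect to an equivalence relation: the probability of jumping into
an equivalence class depends only on the class of the present position. -/
def Lumpable {V : Type*} [Fintype V] {G : SimpleGraph V} (W : GraphWalk G) (r : Setoid V) : Prop :=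
  ∀ x y, r x y → ∀ u, ∑ v with r v u, W.P x v = ∑ v with r v u, W.P y v

/-- `U` is radially symmetric around `o`: the walk is lumpable for some equivalence relation that
isolates `o` and identifies any two points of `U` at the same level (distance from `o`). -/
def RadiallySymmetric {V : Type*} [Fintype V] {G : SimpleGraph V} (W : GraphWalk G) (o : V)
    (U : Set V) : Prop :=
  ∃ r : Setoid V, Lumpable W r ∧ (∀ x, r x o → x = o) ∧
    ∀ x ∈ U, ∀ y ∈ U, G.dist o x = G.dist o y → r x y

/-- A connected graph made of a part `T0` and a *spine*, glued at the vertex `o` (called `0`), and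
of finitely many further parts `T i` (the branches), each glued to the spine at one vertex
`root i`.  The spine runs from `o` to `c`; its initial piece, up to level `z`, is the bottleneck,
and the branches are attached beyond the bottleneck or at its end.  With no branches (`m = 0`)
this is a pair of graphs joined by a bottleneck; when the spine is a line, it is a line with
finite graphs hanging from it. -/
structure BottleneckGraph {V : Type*} [Fintype V] (G : SimpleGraph V) (W : GraphWalk G) where
  connected : G.Connected
  o : V
  T0 : Set V
  spine : Set V
  m : ℕ
  T : Fin m → Set V
  root : Fin m → V
  inter_T0_spine : T0 ∩ spine = {o}
  inter_T_spine : ∀ i, T i ∩ spine = {root i}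
  inter_T0_T : ∀ i, Disjoint T0 (T i)
  inter_T_T : ∀ i j, i ≠ j → T i ∩ T j ⊆ spine
  cover : T0 ∪ spine ∪ ⋃ i, T i = Set.univ
  /-- `T0` is left only through `o`. -/
  exit_T0 : ∀ x y, x ∈ T0 → x ≠ o → G.Adj x y → y ∈ T0
  /-- `T i` is left only through `root i`. -/
  exit_T : ∀ i x y, x ∈ T i → x ≠ root i → G.Adj x y → y ∈ T i
  /-- The length of the bottleneck. -/
  z : ℕ
  z_pos : 0 < z
  root_level : ∀ i, z ≤ G.dist o (root i)
  /-- The far end of the spine. -/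
  c : V
  c_mem : c ∈ edgeOf G o spine
  c_level : z < G.dist o c
  /-- A point of the edge of `T0`. -/
  e : V
  e_mem : e ∈ edgeOf G o T0
  /-- A point of the edge of `T i`. -/
  tip : Fin m → V
  tip_mem : ∀ i, tip i ∈ edgeOf G (root i) (T i)
  radial_T0 : RadiallySymmetric W o T0
  radial_spine : RadiallySymmetric W o spine
  radial_T : ∀ i, RadiallySymmetric W (root i) (T i)

namespace BottleneckGraph

variable {V : Type*} [Fintype V] {G : SimpleGraph V} {W : GraphWalk G}

/-- The bottleneck `B[0,z]`. -/
def B (H : BottleneckGraph G W) : Set V := {x | x ∈ H.spine ∧ G.dist H.o x ≤ H.z}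

/-- The end `z` of the bottleneck, as a set of vertices. -/
def Z (H : BottleneckGraph G W) : Set V := {x | x ∈ H.spine ∧ G.dist H.o x = H.z}

/-- `D = T_0 ∪ B[0,z]`. -/
def D (H : BottleneckGraph G W) : Set V := H.T0 ∪ H.B

/-- `S`, the complement of `D`. -/
def S (H : BottleneckGraph G W) : Set V := H.Dᶜ

/-- `∂D`, the edge of `T_0`. -/
def bdry (H : BottleneckGraph G W) : Set V := edgeOf G H.o H.T0

open Classical in
/-- `π(B[0,z] ∪ S)`. -/
def massBS (H : BottleneckGraph G W) : ℝ := ∑ x with x ∈ H.B ∪ H.S, W.stat x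

/-- `L`, the number of times `s ∈ [τ_0, τ*_z]` with `x_{s-1} ∉ T_0` and `x_s ∈ T_0`, where
`τ*_z = inf {s ≥ τ_0 : x_s = z}`. -/
def returns (H : BottleneckGraph G W) (w : ℕ → V) : ℕ :=
  Set.ncard {s : ℕ | 1 ≤ s ∧ hit {H.o} w ≤ s ∧ (s : ℕ∞) ≤ hitFrom (hit {H.o} w) H.Z w ∧
    w (s - 1) ∉ H.T0 ∧ w s ∈ H.T0}

variable [MeasurableSpace V] [DiscreteMeasurableSpace V]

/-- `E_c(τ_0)`. -/
def Ec (H : BottleneckGraph G W) : ℝ := meanHit W H.c {H.o}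

/-- `√Var_c(τ_0)`. -/
def sdc (H : BottleneckGraph G W) : ℝ := sdHit W H.c {H.o}

/-- `E_∂D(τ_0)`; by radial symmetry all points of `∂D` give the same value. -/
def Ebdry (H : BottleneckGraph G W) : ℝ := meanHit W H.e {H.o}

/-- `√Var_∂D(τ_0)`. -/
def sdbdry (H : BottleneckGraph G W) : ℝ := sdHit W H.e {H.o}

/-- `E[L]`, for the walk observed from time `τ_0` on, that is, started at `0`. -/
def meanL (H : BottleneckGraph G W) : ℝ := ∫ w, (H.returns w : ℝ) ∂(pathLaw W H.o)

/-- `P(L ≤ a)`. -/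
def probLLe (H : BottleneckGraph G W) (a : ℕ) : ℝ := (pathLaw W H.o).real {w | H.returns w ≤ a}

/-- The mean length of an excursion of the walk from `0` into `U` (first step into `U \ {0}`, up
to the return to `0`), conditioned to return to `0` before hitting `K`. -/
def meanExcursion (H : BottleneckGraph G W) (U K : Set V) : ℝ :=
  ∫ w, ((hitFrom 1 {H.o} w).toNat : ℝ)
    ∂(cond (pathLaw W H.o) {w | w 1 ∈ U \ {H.o} ∧ hitFrom 1 {H.o} w < hit K w})

/-- `E[θ]`: excursions into the bottleneck, conditioned not to hit `z`. -/
def meanTheta (H : BottleneckGraph G W) : ℝ := H.meanExcursion H.B H.Z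

/-- `E[λ]`: excursions into `T_0`, conditioned not to hit the edge of `T_0`. -/
def meanLambda (H : BottleneckGraph G W) : ℝ := H.meanExcursion H.T0 H.bdry

end BottleneckGraph

end

/-! The vertex `0` serves as a regeneration point: the walk is well mixed when started there, and
every starting point reaches it in time. Mixing from `0`. Almost all stationary mass lies in `T0`,
where radial symmetry makes `∂D` the worst start, so by Markov's inequality a stationary walk hits
`0` within `s ≈ K · E_∂D(τ_0)` steps up to a small error. Hence few returns: `P^(2a)(0,0) ≤ 9 π(0)`
as soon as `s ≤ 2a + 1`. Reversibility and laziness turn this into `|P^j(0,A) - P^(j+1)(0,A)| =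
O(1/(α a))` for `j ≥ 2a` (`abs_occ_succ_sub_le`). If `s ≪ a`, the occupation probability of `A` is
nearly constant over windows of length `s`; since a stationary walk hits `0` in such a window, the
constant must be close to `π(A)` (`abs_occ_sub_stat_le`). Reaching `0`. Starts in `T0` or in a
branch reach `0` or the root by Markov's inequality; on the spine, radial symmetry makes `c` the
worst start, and Chebyshev's inequality applies there (`surv_add_le_of_mean`). Both parts fit in the
allowed time because `E_∂D(τ_0)` is negligible against `γ √Var_c(τ_0) / A` (`floor_mem_mixedTimes`).
The argument runs on survival probabilities given by a first-step recursion, linked to path space by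
`pathLaw_lt_hit`. -/

namespace GraphWalk

variable {V : Type*} [Fintype V] {G : SimpleGraph V} (W : GraphWalk G)

/-! ### Survival probabilities, symmetry and barriers -/

open Classical in
/-- The probability that the walk started at `x` has not hit `u` up to time `n`, defined through
the first step of the walk. -/
noncomputable def surv (u : V) : ℕ → V → ℝ
  | 0, x => if x = u then 0 else 1
  | n + 1, x => if x = u then 0 else ∑ y, W.P x y * surv u n y

lemma surv_self (u : V) (n : ℕ) : W.surv u n u = 0 := by
  cases n <;> simp [surv]

lemma surv_zero_of_ne {u x : V} (hx : x ≠ u) : W.surv u 0 x = 1 := by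
  simp [surv, hx]

lemma surv_succ_of_ne {u x : V} (hx : x ≠ u) (n : ℕ) :
    W.surv u (n + 1) x = ∑ y, W.P x y * W.surv u n y := by
  simp [surv, hx]

lemma sum_mul_le (x : V) {f g : V → ℝ} (hfg : ∀ y, f y ≤ g y) :
    ∑ y, W.P x y * f y ≤ ∑ y, W.P x y * g y :=
  Finset.sum_le_sum fun y _ => mul_le_mul_of_nonneg_left (hfg y) (W.nonneg x y)

lemma sum_mul_const (x : V) (a : ℝ) : ∑ y, W.P x y * a = a := by
  rw [← Finset.sum_mul, W.row_sum, one_mul]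

lemma surv_nonneg (u : V) (n : ℕ) (x : V) : 0 ≤ W.surv u n x := by
  induction n generalizing x with
  | zero => simp only [surv]; split_ifs <;> norm_num
  | succ n ih =>
    simp only [surv]; split_ifs
    · rfl
    · exact Finset.sum_nonneg fun y _ => mul_nonneg (W.nonneg x y) (ih y)

lemma surv_le_one (u : V) (n : ℕ) (x : V) : W.surv u n x ≤ 1 := by
  induction n generalizing x with
  | zero => simp only [surv]; split_ifs <;> norm_num
  | succ n ih =>
    simp only [surv]; split_ifs
    · norm_num
    · exact (W.sum_mul_le x ih).trans_eq (W.sum_mul_const x 1)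

lemma surv_succ_le (u : V) (n : ℕ) (x : V) : W.surv u (n + 1) x ≤ W.surv u n x := by
  by_cases hx : x = u
  · simp [hx, surv_self]
  induction n generalizing x with
  | zero => rw [W.surv_zero_of_ne hx]; exact W.surv_le_one u 1 x
  | succ n ih =>
    rw [W.surv_succ_of_ne hx, W.surv_succ_of_ne hx]
    refine W.sum_mul_le x fun y => ?_
    by_cases hy : y = u
    · simp [hy, surv_self]
    · exact ih y hy

lemma surv_antitone (u x : V) : Antitone fun n => W.surv u n x :=
  antitone_nat_of_succ_le fun n => W.surv_succ_le u n x

/-- Equivalent points have the same hitting law of an isolated point. -/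
lemma surv_eq_of_rel {r : Setoid V} (hr : Lumpable W r) {u : V} (hu : ∀ x, r x u → x = u)
    (n : ℕ) {x y : V} (hxy : r x y) : W.surv u n x = W.surv u n y := by
  classical
  by_cases hx : x = u
  · subst hx; rw [hu y (r.symm hxy)]
  have hy : y ≠ u := by rintro rfl; exact hx (hu x hxy)
  induction n generalizing x y with
  | zero => rw [W.surv_zero_of_ne hx, W.surv_zero_of_ne hy]
  | succ n ih =>
    rw [W.surv_succ_of_ne hx, W.surv_succ_of_ne hy]
    have hcls : ∀ a b, r a b → W.surv u n a = W.surv u n b := by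
      intro a b hab
      by_cases ha : a = u
      · subst ha; rw [hu b (r.symm hab)]
      · exact ih hab ha (by rintro rfl; exact ha (hu a hab))
    -- Grouping targets by class leaves only class-jump probabilities, which lumpability equates for
    -- `x` and `y`.
    have key : ∀ w, ∑ v, W.P w v * W.surv u n v
        = ∑ q : Quotient r, (∑ v with r v q.out, W.P w v) * W.surv u n q.out := by
      intro w
      rw [← Finset.sum_fiberwise (s := Finset.univ) (g := fun v => (Quotient.mk r v))]
      refine Finset.sum_congr rfl fun q _ => ?_
      rw [Finset.sum_mul]
      refine Finset.sum_congr ?_ fun v hv => ?_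
      · ext v
        simp only [Finset.mem_filter, Finset.mem_univ, true_and]
        conv_lhs => rw [← q.out_eq]
        exact Quotient.eq
      · rw [hcls v q.out (by simpa using hv)]
    rw [key x, key y]
    refine Finset.sum_congr rfl fun q _ => ?_
    congr 1
    convert hr x y hxy q.out using 2

/-- If the walk cannot leave `F` without passing through points with the hitting law of `x`, then
points of `F` hit `u` later than `x`. -/
lemma surv_le_of_barrier {u x : V} {F : Set V} (hu : u ∉ F)
    (hF : ∀ y ∈ F, (∀ n, W.surv u n y = W.surv u n x) ∨ ∀ y', G.Adj y y' → y' ∈ F)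
    (n : ℕ) {y : V} (hy : y ∈ F) : W.surv u n x ≤ W.surv u n y := by
  have hne : ∀ y ∈ F, y ≠ u := by rintro y hy rfl; exact hu hy
  induction n generalizing y with
  | zero => rw [W.surv_zero_of_ne (hne y hy)]; exact W.surv_le_one _ _ _
  | succ n ih =>
    rcases hF y hy with h | h
    · exact (h _).ge
    · rw [W.surv_succ_of_ne (hne y hy)]
      -- Lowering the time for `x` lets the induction hypothesis apply to every successor of `y`.
      refine (W.surv_succ_le u n x).trans ?_
      rw [← W.sum_mul_const y (W.surv u n x)]
      refine Finset.sum_le_sum fun y' _ => ?_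
      rcases (W.nonneg y y').eq_or_lt with h0 | h0
      · simp [← h0]
      · refine mul_le_mul_of_nonneg_left (ih ?_) h0.le
        by_cases hyy : y = y'
        · exact hyy ▸ hy
        · exact h y' ((W.pos_iff_adj y y' hyy).1 h0)

/-- An edge changes the distance to `u` by at most one, so from beyond the level of `x` the walk
must cross that level, all of whose points in `U` share the hitting law of `x`. This level is the
barrier. -/
lemma surv_le_of_edgeOf {u e : V} {U : Set V} (hG : G.Connected) (hU : u ∈ U)
    (hexit : ∀ x y, x ∈ U → x ≠ u → G.Adj x y → y ∈ U)
    (hr : RadiallySymmetric W u U) (he : e ∈ edgeOf G u U) (n : ℕ) {x : V} (hx : x ∈ U) :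
    W.surv u n x ≤ W.surv u n e := by
  obtain ⟨r, hl, hu, hlev⟩ := hr
  by_cases hxu : x = u
  · rw [hxu, surv_self]; exact W.surv_nonneg _ _ _
  have hpos : 0 < G.dist u x := hG.pos_dist_of_ne (Ne.symm hxu)
  refine W.surv_le_of_barrier (F := {y | y ∈ U ∧ G.dist u x ≤ G.dist u y}) ?_ ?_ n
    ⟨he.1, he.2 x hx⟩
  · rintro ⟨-, h⟩
    rw [SimpleGraph.dist_self] at h; omega
  · rintro y ⟨hyU, hy⟩
    rcases hy.eq_or_lt with h | h
    · exact Or.inl fun n => W.surv_eq_of_rel hl hu n (hlev y hyU x hx h.symm)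
    · refine Or.inr fun y' hadj => ⟨hexit y y' hyU ?_ hadj, ?_⟩
      · rintro rfl; rw [SimpleGraph.dist_self] at h; omega
      · have := hG.dist_triangle (u := u) (v := y') (w := y)
        rw [SimpleGraph.dist_eq_one_iff_adj.2 hadj.symm] at this
        omega

/-- To miss `u` up to time `a + b`, the walk must miss `v` up to time `a`, or miss `u` for `b`
steps after having visited `v`. -/
lemma surv_add_le (u v : V) (a b : ℕ) (x : V) :
    W.surv u (a + b) x ≤ W.surv v a x + W.surv u b v := by
  induction a generalizing x with
  | zero =>
    by_cases hx : x = v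
    · subst hx; simp [surv_self]
    · rw [W.surv_zero_of_ne hx]
      linarith [W.surv_le_one u (0 + b) x, W.surv_nonneg u b v]
  | succ a ih =>
    by_cases hx : x = v
    · subst hx
      rw [surv_self, zero_add]
      exact W.surv_antitone u x (by omega)
    by_cases hu : x = u
    · subst hu
      rw [surv_self]
      exact add_nonneg (W.surv_nonneg _ _ _) (W.surv_nonneg _ _ _)
    rw [show a + 1 + b = a + b + 1 by ring, W.surv_succ_of_ne hu, W.surv_succ_of_ne hx]
    refine (W.sum_mul_le x ih).trans_eq ?_
    simp only [mul_add, Finset.sum_add_distrib]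
    rw [sum_mul_const]

/-! ### Geometric tails of hitting times -/

lemma exists_surv_lt_one (hG : G.Connected) (u x : V) : ∃ n, W.surv u n x < 1 := by
  obtain ⟨p⟩ := hG.preconnected x u
  induction p with
  | nil => exact ⟨0, by rw [surv_self]; norm_num⟩
  | @cons a b c hab p ih =>
    obtain ⟨n, hn⟩ := ih
    refine ⟨n + 1, ?_⟩
    by_cases ha : a = c
    · rw [ha, surv_self]; norm_num
    rw [W.surv_succ_of_ne ha, ← W.row_sum a]
    refine Finset.sum_lt_sum (fun y _ => mul_le_of_le_one_right (W.nonneg a y)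
      (W.surv_le_one _ _ _)) ⟨b, Finset.mem_univ _, ?_⟩
    exact mul_lt_of_lt_one_right ((W.pos_iff_adj a b hab.ne).2 hab) hn

/-- Markov property at time `n`: wherever the surviving walk stands, it misses `u` for `N` more
steps with probability at most `ρ`. -/
lemma surv_add_le_mul {u : V} {N : ℕ} {ρ : ℝ} (hρ : ∀ x, W.surv u N x ≤ ρ) (n : ℕ) (x : V) :
    W.surv u (n + N) x ≤ ρ * W.surv u n x := by
  induction n generalizing x with
  | zero =>
    by_cases hx : x = u
    · simp [hx, surv_self]
    · rw [W.surv_zero_of_ne hx, zero_add, mul_one]; exact hρ x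
  | succ n ih =>
    by_cases hx : x = u
    · simp [hx, surv_self]
    rw [show n + 1 + N = n + N + 1 by ring, W.surv_succ_of_ne hx, W.surv_succ_of_ne hx,
      Finset.mul_sum]
    refine (W.sum_mul_le x ih).trans_eq (Finset.sum_congr rfl fun y _ => by ring)

lemma exists_surv_mul_le (hG : G.Connected) (u : V) :
    ∃ N : ℕ, 0 < N ∧ ∃ ρ : ℝ, 0 ≤ ρ ∧ ρ < 1 ∧ ∀ k x, W.surv u (N * k) x ≤ ρ ^ k := by
  choose n hn using W.exists_surv_lt_one hG u
  have hne : (Finset.univ : Finset V).Nonempty := ⟨u, Finset.mem_univ u⟩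
  set N := Finset.univ.sup n + 1
  have hN : ∀ x, W.surv u N x < 1 := fun x =>
    (W.surv_antitone u x ((Finset.le_sup (f := n) (Finset.mem_univ x)).trans
      (Nat.le_succ _))).trans_lt (hn x)
  refine ⟨N, Nat.succ_pos _, Finset.univ.sup' hne (W.surv u N), ?_, ?_, ?_⟩
  · exact (W.surv_nonneg u N u).trans (Finset.le_sup' _ (Finset.mem_univ u))
  · exact (Finset.sup'_lt_iff hne).2 fun x _ => hN x
  · have hρ : ∀ x, W.surv u N x ≤ Finset.univ.sup' hne (W.surv u N) :=
      fun x => Finset.le_sup' _ (Finset.mem_univ x)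
    intro k
    induction k with
    | zero => intro x; simpa using W.surv_le_one u 0 x
    | succ k ih =>
      intro x
      rw [Nat.mul_succ, pow_succ']
      exact (W.surv_add_le_mul hρ _ x).trans (mul_le_mul_of_nonneg_left (ih x)
        ((W.surv_nonneg u N u).trans (hρ u)))

/-- The weights `2n + 1` sum to squares, so this is finiteness of the second moment of the hitting
time. Cutting time into blocks of length `N` gives geometric decay from block to block. -/
lemma summable_mul_surv (hG : G.Connected) (u x : V) :
    Summable fun n : ℕ => (2 * n + 1 : ℝ) * W.surv u n x := by
  obtain ⟨N, hN, ρ, h0, h1, h⟩ := W.exists_surv_mul_le hG u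
  have hs : Summable fun p : ℕ × Fin N => (2 * (N * p.1 + N) + 1 : ℝ) * ρ ^ p.1 := by
    have hg : Summable fun k : ℕ => (2 * (N * k + N) + 1 : ℝ) * ρ ^ k := by
      have e1 := (summable_geometric_of_lt_one h0 h1).mul_left (2 * N + 1 : ℝ)
      have e2 := (summable_pow_mul_geometric_of_norm_lt_one 1
        (show ‖ρ‖ < 1 by rwa [Real.norm_of_nonneg h0])).mul_left (2 * N : ℝ)
      refine (e1.add e2).congr fun k => ?_
      ring
    have hnn : 0 ≤ fun p : ℕ × Fin N => (2 * (N * p.1 + N) + 1 : ℝ) * ρ ^ p.1 :=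
      fun p => by positivity
    rw [summable_prod_of_nonneg hnn]
    refine ⟨fun k => Summable.of_finite, ?_⟩
    simpa using hg.mul_left (N : ℝ)
  have : NeZero N := ⟨hN.ne'⟩
  rw [← (Nat.divModEquiv N).symm.summable_iff]
  refine Summable.of_nonneg_of_le (fun p => mul_nonneg (by positivity) (W.surv_nonneg _ _ _))
    (fun p => ?_) hs
  simp only [Function.comp, Nat.divModEquiv_symm_apply]
  have hp : (p.2 : ℕ) ≤ N := p.2.2.le
  have hv : ((p.1 * N + (p.2 : ℕ) : ℕ) : ℝ) ≤ N * p.1 + N := by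
    have : ((p.2 : ℕ) : ℝ) ≤ N := by exact_mod_cast hp
    push_cast; linarith
  refine mul_le_mul (by linarith) ?_ (W.surv_nonneg _ _ _) (by positivity)
  refine (W.surv_antitone u x (?_ : N * p.1 ≤ _)).trans (h p.1 x)
  rw [mul_comm]; exact Nat.le_add_right _ _

end GraphWalk

/-! ### Worst starting points in the glued graph -/

namespace BottleneckGraph

variable {V : Type*} [Fintype V] {G : SimpleGraph V} {W : GraphWalk G} (H : BottleneckGraph G W)

lemma o_mem : H.o ∈ H.T0 ∩ H.spine := by rw [H.inter_T0_spine]; rfl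

lemma root_mem (i : Fin H.m) : H.root i ∈ H.T i ∩ H.spine := by rw [H.inter_T_spine]; rfl

lemma surv_le_surv_e (n : ℕ) {x : V} (hx : x ∈ H.T0) : W.surv H.o n x ≤ W.surv H.o n H.e :=
  W.surv_le_of_edgeOf H.connected H.o_mem.1 H.exit_T0 H.radial_T0 H.e_mem n hx

lemma surv_le_surv_tip (i : Fin H.m) (n : ℕ) {x : V} (hx : x ∈ H.T i) :
    W.surv (H.root i) n x ≤ W.surv (H.root i) n (H.tip i) :=
  W.surv_le_of_edgeOf H.connected (H.root_mem i).1 (H.exit_T i) (H.radial_T i) (H.tip_mem i) n hx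

/-- The walk may leave the spine through branches, so the region beyond the level of `x` is enlarged
by every branch rooted at or beyond that level. A branch is left only through its root, so the
barrier is still the spine level of `x`. -/
lemma surv_le_surv_c (n : ℕ) {x : V} (hx : x ∈ H.spine) : W.surv H.o n x ≤ W.surv H.o n H.c := by
  obtain ⟨r, hl, hu, hlev⟩ := H.radial_spine
  by_cases hxo : x = H.o
  · rw [hxo, W.surv_self]; exact W.surv_nonneg _ _ _
  have hpos : 0 < G.dist H.o x := H.connected.pos_dist_of_ne (Ne.symm hxo)
  have ho : ∀ i, H.o ∉ H.T i := fun i h => (H.inter_T0_T i).le_bot ⟨H.o_mem.1, h⟩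
  refine W.surv_le_of_barrier (F := {y | (y ∈ H.spine ∧ G.dist H.o x ≤ G.dist H.o y) ∨
    ∃ i, y ∈ H.T i ∧ G.dist H.o x ≤ G.dist H.o (H.root i)}) ?_ ?_ n
    (Or.inl ⟨H.c_mem.1, H.c_mem.2 x hx⟩)
  · rintro (⟨-, h⟩ | ⟨i, h, -⟩)
    · rw [SimpleGraph.dist_self] at h; omega
    · exact ho i h
  have hspine : ∀ y ∈ H.spine, G.dist H.o x ≤ G.dist H.o y →
      (∀ n, W.surv H.o n y = W.surv H.o n x) ∨ ∀ y', G.Adj y y' →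
        (y' ∈ H.spine ∧ G.dist H.o x ≤ G.dist H.o y') ∨
        ∃ i, y' ∈ H.T i ∧ G.dist H.o x ≤ G.dist H.o (H.root i) := by
    intro y hyU hy
    rcases hy.eq_or_lt with h | h
    · exact Or.inl fun n => W.surv_eq_of_rel hl hu n (hlev y hyU x hx h.symm)
    refine Or.inr fun y' hadj => ?_
    have hd : G.dist H.o x ≤ G.dist H.o y' := by
      have := H.connected.dist_triangle (u := H.o) (v := y') (w := y)
      rw [SimpleGraph.dist_eq_one_iff_adj.2 hadj.symm] at this
      omega
    have hyo : y ≠ H.o := by rintro rfl; rw [SimpleGraph.dist_self] at h; omega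
    have hy'o : y' ≠ H.o := by rintro rfl; rw [SimpleGraph.dist_self] at hd; omega
    have hcov : y' ∈ H.T0 ∪ H.spine ∪ ⋃ i, H.T i := by rw [H.cover]; trivial
    rcases hcov with (h0 | hs) | ht
    · have : y ∈ H.T0 ∩ H.spine := ⟨H.exit_T0 y' y h0 hy'o hadj.symm, hyU⟩
      rw [H.inter_T0_spine] at this
      exact absurd this hyo
    · exact Or.inl ⟨hs, hd⟩
    · obtain ⟨i, hi⟩ := Set.mem_iUnion.1 ht
      by_cases hroot : y' = H.root i
      · exact Or.inl ⟨hroot ▸ (H.root_mem i).2, hd⟩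
      · have : y ∈ H.T i ∩ H.spine := ⟨H.exit_T i y' y hi hroot hadj.symm, hyU⟩
        rw [H.inter_T_spine] at this
        rw [Set.mem_singleton_iff] at this
        exact Or.inr ⟨i, hi, this ▸ hy⟩
  rintro y (⟨hyU, hy⟩ | ⟨i, hyi, hy⟩)
  · exact hspine y hyU hy
  · by_cases hroot : y = H.root i
    · subst hroot; exact hspine _ (H.root_mem i).2 hy
    · exact Or.inr fun y' hadj => Or.inr ⟨i, H.exit_T i y y' hyi hroot hadj, hy⟩

end BottleneckGraph

/-! ### Stationarity, occupation probabilities and returns -/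

namespace GraphWalk

variable {V : Type*} [Fintype V] {G : SimpleGraph V} (W : GraphWalk G)

lemma stat_pos (hG : G.Connected) (x : V) : 0 < W.stat x := by
  obtain ⟨y, -, hy⟩ : ∃ y ∈ Finset.univ, 0 < W.stat y :=
    Finset.exists_lt_of_sum_lt (f := fun _ => 0) (by simp [W.stat_sum])
  obtain ⟨p⟩ := hG.preconnected x y
  induction p with
  | nil => exact hy
  | @cons a b c hab p ih =>
    have h1 := mul_pos (ih hy) ((W.pos_iff_adj b a hab.ne').2 hab.symm)
    rw [W.reversible] at h1
    exact pos_of_mul_pos_left h1 (W.nonneg _ _)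

lemma sum_stat_mul (f : V → ℝ) :
    ∑ x, W.stat x * ∑ y, W.P x y * f y = ∑ y, W.stat y * f y := by
  simp only [Finset.mul_sum]
  rw [Finset.sum_comm]
  refine Finset.sum_congr rfl fun y _ => ?_
  have : ∀ x, W.stat x * (W.P x y * f y) = W.stat y * f y * W.P y x := fun x => by
    rw [← mul_assoc, W.reversible]; ring
  simp only [this]
  rw [← Finset.mul_sum, W.row_sum, mul_one]

variable [DecidableEq V]

lemma pow_nonneg (n : ℕ) (x y : V) : 0 ≤ (W.P ^ n) x y := by
  induction n generalizing x with
  | zero => rw [pow_zero, Matrix.one_apply]; split_ifs <;> norm_num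
  | succ n ih =>
    rw [pow_succ', Matrix.mul_apply]
    exact Finset.sum_nonneg fun z _ => mul_nonneg (W.nonneg x z) (ih z)

/-- The probability that the walk started at `x` is in `A` at time `n`. -/
noncomputable def occ (A : Finset V) (n : ℕ) (x : V) : ℝ := ∑ y ∈ A, (W.P ^ n) x y

lemma occ_succ (A : Finset V) (n : ℕ) (x : V) :
    W.occ A (n + 1) x = ∑ y, W.P x y * W.occ A n y := by
  simp only [occ, pow_succ', Matrix.mul_apply, Finset.mul_sum]
  rw [Finset.sum_comm]

lemma occ_nonneg (A : Finset V) (n : ℕ) (x : V) : 0 ≤ W.occ A n x :=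
  Finset.sum_nonneg fun y _ => W.pow_nonneg n x y

lemma occ_le_one (A : Finset V) (n : ℕ) (x : V) : W.occ A n x ≤ 1 := by
  induction n generalizing x with
  | zero =>
    simp only [occ, pow_zero, Matrix.one_apply, Finset.sum_ite_eq]
    split_ifs <;> norm_num
  | succ n ih =>
    rw [occ_succ]
    exact (W.sum_mul_le x ih).trans_eq (W.sum_mul_const x 1)

lemma sum_stat_mul_occ (A : Finset V) (n : ℕ) :
    ∑ x, W.stat x * W.occ A n x = ∑ x ∈ A, W.stat x := by
  induction n with
  | zero => simp [occ, Matrix.one_apply]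
  | succ n ih => simp only [occ_succ]; rw [sum_stat_mul, ih]

/-- If from `u` the occupation probability of `A` is close to `v` throughout a time window, then
from `x` it is close to `v` at the end of the window, up to the probability of missing `u`. -/
lemma abs_occ_sub_le {A : Finset V} {u : V} {v η : ℝ} (hv0 : 0 ≤ v) (hv1 : v ≤ 1) (hη : 0 ≤ η)
    {M n : ℕ} (h : ∀ j ≤ n, |W.occ A (M + j) u - v| ≤ η) (x : V) :
    |W.occ A (M + n) x - v| ≤ η + W.surv u n x := by
  induction n generalizing x with
  | zero =>
    by_cases hx : x = u
    · rw [hx, surv_self]; exact (h 0 le_rfl).trans_eq (add_zero η).symm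
    · rw [W.surv_zero_of_ne hx, abs_le]
      have h0 := W.occ_nonneg A (M + 0) x
      have h1 := W.occ_le_one A (M + 0) x
      constructor <;> linarith
  | succ n ih =>
    by_cases hx : x = u
    · rw [hx, surv_self, add_zero]; exact h _ le_rfl
    · rw [W.surv_succ_of_ne hx, ← add_assoc, occ_succ]
      have e : ∑ y, W.P x y * W.occ A (M + n) y - v
          = ∑ y, W.P x y * (W.occ A (M + n) y - v) := by
        simp only [mul_sub, Finset.sum_sub_distrib, sum_mul_const]
      rw [e]
      refine (Finset.abs_sum_le_sum_abs _ _).trans ?_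
      simp only [abs_mul, abs_of_nonneg (W.nonneg x _)]
      refine (W.sum_mul_le x (ih fun j hj => h j (by omega))).trans_eq ?_
      simp only [mul_add, Finset.sum_add_distrib, sum_mul_const]

lemma occ_singleton (n : ℕ) (x y : V) : W.occ {y} n x = (W.P ^ n) x y := by simp [occ]

/-- If `u` is reached within `n` steps, at least `M` time points of the window `n + M` are left,
counting the arrival itself. -/
lemma mul_sum_pow_le (u : V) (n M : ℕ) (x : V) :
    (1 - W.surv u n x) * ∑ i ∈ Finset.range M, W.occ {u} i u
      ≤ ∑ j ∈ Finset.range (n + M), W.occ {u} j x := by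
  have hmono : ∀ n, ∑ i ∈ Finset.range M, W.occ {u} i u
      ≤ ∑ j ∈ Finset.range (n + M), W.occ {u} j u := fun n =>
    Finset.sum_le_sum_of_subset_of_nonneg
      (Finset.range_mono (Nat.le_add_left M n)) fun _ _ _ => W.occ_nonneg _ _ _
  induction n generalizing x with
  | zero =>
    by_cases hx : x = u
    · rw [hx, surv_self, sub_zero, one_mul]; exact hmono 0
    · rw [W.surv_zero_of_ne hx, sub_self, zero_mul]
      exact Finset.sum_nonneg fun _ _ => W.occ_nonneg _ _ _
  | succ n ih =>
    by_cases hx : x = u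
    · rw [hx, surv_self, sub_zero, one_mul]; exact hmono _
    · rw [show n + 1 + M = n + M + 1 by ring, Finset.sum_range_succ', W.surv_succ_of_ne hx]
      refine le_trans ?_ (le_add_of_nonneg_right (W.occ_nonneg _ _ _))
      simp only [occ_succ]
      rw [Finset.sum_comm]
      simp only [← Finset.mul_sum]
      refine le_trans (le_of_eq ?_) (W.sum_mul_le x ih)
      simp only [← mul_assoc, ← Finset.sum_mul]
      simp only [mul_sub, mul_one, Finset.sum_sub_distrib, W.row_sum]

/-- Few returns: the expected number of visits to `u` in a time window is comparable with its
stationary value, provided that the stationary walk hits `u` in that window. -/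
lemma sum_pow_le {u : V} {n M : ℕ} (hq : ∑ x, W.stat x * W.surv u n x ≤ 1 / 2) :
    ∑ i ∈ Finset.range M, W.occ {u} i u ≤ 2 * ((n + M : ℕ) * W.stat u) := by
  -- Averaging over a stationary start makes the expected number of visits exactly `(n + M) π(u)`.
  have h1 := Finset.sum_le_sum fun x (_ : x ∈ Finset.univ) =>
    mul_le_mul_of_nonneg_left (W.mul_sum_pow_le u n M x) (W.stat_nonneg x)
  have h2 : ∑ x, W.stat x * ∑ j ∈ Finset.range (n + M), W.occ {u} j x
      = (n + M : ℕ) * W.stat u := by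
    simp only [Finset.mul_sum]
    rw [Finset.sum_comm]
    simp only [sum_stat_mul_occ]
    simp
  rw [h2] at h1
  have h3 : ∑ x, W.stat x * ((1 - W.surv u n x) * ∑ i ∈ Finset.range M, W.occ {u} i u)
      = (1 - ∑ x, W.stat x * W.surv u n x) * ∑ i ∈ Finset.range M, W.occ {u} i u := by
    simp only [← mul_assoc, ← Finset.sum_mul]
    simp only [mul_sub, mul_one, Finset.sum_sub_distrib, W.stat_sum]
  rw [h3] at h1
  have h4 : 0 ≤ ∑ i ∈ Finset.range M, W.occ {u} i u :=
    Finset.sum_nonneg fun _ _ => W.occ_nonneg _ _ _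
  nlinarith

/-! ### Spectral estimates -/

/-- Gershgorin's argument at a maximum of `|f|`: `|l - P(x,x)| ≤ 1 - P(x,x)`. -/
lemma eigenvalue_bounds {l α : ℝ} (hα : ∀ x, α ≤ W.P x x) {f : V → ℝ} (hf : f ≠ 0)
    (h : ∀ x, ∑ y, W.P x y * f y = l * f x) : 2 * α - 1 ≤ l ∧ l ≤ 1 := by
  obtain ⟨w, hw⟩ := Function.ne_iff.1 hf
  obtain ⟨x, -, hx⟩ := Finset.exists_max_image Finset.univ (fun x => |f x|) ⟨w, Finset.mem_univ w⟩
  have hpos : 0 < |f x| := (abs_pos.2 hw).trans_le (hx w (Finset.mem_univ w))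
  have hs : (l - W.P x x) * f x = ∑ y ∈ Finset.univ.erase x, W.P x y * f y := by
    rw [sub_mul, ← h x, ← Finset.add_sum_erase _ _ (Finset.mem_univ x)]; ring
  have hr : ∑ y ∈ Finset.univ.erase x, W.P x y = 1 - W.P x x := by
    rw [← W.row_sum x, ← Finset.add_sum_erase _ _ (Finset.mem_univ x)]; ring
  have hb : |l - W.P x x| * |f x| ≤ (1 - W.P x x) * |f x| := by
    rw [← abs_mul, hs, ← hr, Finset.sum_mul]
    refine (Finset.abs_sum_le_sum_abs _ _).trans (Finset.sum_le_sum fun y _ => ?_)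
    rw [abs_mul, abs_of_nonneg (W.nonneg x y)]
    exact mul_le_mul_of_nonneg_left (hx y (Finset.mem_univ y)) (W.nonneg x y)
  have := abs_le.1 (le_of_mul_le_mul_right hb hpos)
  constructor <;> linarith [hα x]

lemma _root_.Matrix.IsHermitian.pow_apply_eq_sum {S : Matrix V V ℝ} (hS : S.IsHermitian) (n : ℕ)
    (x y : V) : (S ^ n) x y = ∑ i, hS.eigenvalues i ^ n *
      (hS.eigenvectorBasis i x * hS.eigenvectorBasis i y) := by
  set U : Matrix V V ℝ := (hS.eigenvectorUnitary : Matrix V V ℝ) with hU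
  have hUU : U * star U = 1 := Unitary.coe_mul_star_self _
  have h1 : S * U = U * Matrix.diagonal hS.eigenvalues := by
    ext a b
    have := congrFun (hS.mulVec_eigenvectorBasis b) a
    rw [Matrix.mul_diagonal, Matrix.mul_apply]
    simp only [Matrix.mulVec, dotProduct, Pi.smul_apply, smul_eq_mul] at this
    simp only [hU, Matrix.IsHermitian.eigenvectorUnitary_apply]
    rw [this, mul_comm]
  have h2 : S ^ n * U = U * Matrix.diagonal (fun i => hS.eigenvalues i ^ n) := by
    induction n with
    | zero => simp
    | succ n ih =>
      rw [pow_succ, mul_assoc, h1, ← mul_assoc, ih, mul_assoc, Matrix.diagonal_mul_diagonal]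
      simp only [pow_succ]
  have h3 : S ^ n = U * Matrix.diagonal (fun i => hS.eigenvalues i ^ n) * star U := by
    rw [← h2, mul_assoc, hUU, mul_one]
  rw [h3, Matrix.mul_apply]
  refine Finset.sum_congr rfl fun i _ => ?_
  rw [Matrix.mul_diagonal, Matrix.star_apply]
  simp only [hU, Matrix.IsHermitian.eigenvectorUnitary_apply, star_trivial]
  ring

/-- Reversibility makes the conjugate of `P` by the diagonal matrix of `√π` symmetric; the spectral
theorem is applied to it and pulled back. -/
lemma exists_spectral (hG : G.Connected) {α : ℝ} (hα : ∀ x, α ≤ W.P x x) :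
    ∃ (l : V → ℝ) (φ : V → V → ℝ), (∀ i, 2 * α - 1 ≤ l i ∧ l i ≤ 1) ∧
      (∀ x y, ∑ i, φ i x * φ i y = if x = y then 1 else 0) ∧
      ∀ n x y, √(W.stat x) * (W.P ^ n) x y = (∑ i, l i ^ n * (φ i x * φ i y)) * √(W.stat y) := by
  have hp : ∀ x, 0 < √(W.stat x) := fun x => Real.sqrt_pos.2 (W.stat_pos hG x)
  set S : Matrix V V ℝ := Matrix.of fun x y => √(W.stat x) * W.P x y / √(W.stat y) with hS
  have hH : S.IsHermitian := by
    ext x y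
    simp only [Matrix.conjTranspose_apply, hS, star_trivial, Matrix.of_apply]
    rw [div_eq_div_iff (hp x).ne' (hp y).ne']
    calc √(W.stat y) * W.P y x * √(W.stat y) = W.stat y * W.P y x := by
          rw [mul_right_comm, Real.mul_self_sqrt (W.stat_nonneg y)]
      _ = W.stat x * W.P x y := W.reversible y x
      _ = _ := by rw [mul_right_comm, Real.mul_self_sqrt (W.stat_nonneg x)]
  have hpow : ∀ n x y, √(W.stat x) * (W.P ^ n) x y = (S ^ n) x y * √(W.stat y) := by
    intro n
    induction n with
    | zero => intro x y; by_cases h : x = y <;> simp [h]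
    | succ n ih =>
      intro x y
      rw [pow_succ, pow_succ, Matrix.mul_apply, Matrix.mul_apply, Finset.mul_sum, Finset.sum_mul]
      refine Finset.sum_congr rfl fun z _ => ?_
      rw [← mul_assoc, ih]
      simp only [hS, Matrix.of_apply]
      field_simp [(hp y).ne']
  refine ⟨hH.eigenvalues, fun i x => hH.eigenvectorBasis i x, fun i => ?_, fun x y => ?_,
    fun n x y => ?_⟩
  · refine W.eigenvalue_bounds hα (f := fun x => hH.eigenvectorBasis i x / √(W.stat x)) ?_ ?_
    · intro h0
      apply hH.eigenvectorBasis.orthonormal.ne_zero i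
      ext x
      have := congrFun h0 x
      simpa [(hp x).ne'] using this
    · intro x
      have := congrFun (hH.mulVec_eigenvectorBasis i) x
      simp only [Matrix.mulVec, dotProduct, Pi.smul_apply, smul_eq_mul, hS, Matrix.of_apply] at this
      rw [← mul_div_assoc, ← this, Finset.sum_div]
      refine Finset.sum_congr rfl fun y _ => ?_
      field_simp [(hp x).ne', (hp y).ne']
  -- The zeroth power of the spectral expansion is the completeness relation.
  · have := hH.pow_apply_eq_sum 0 x y
    simp only [pow_zero, one_mul, Matrix.one_apply] at this
    exact this.symm
  · rw [hpow, hH.pow_apply_eq_sum]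

/-- For `0 ≤ q ≤ 1`, `(b + 1) q^b (1 - q) ≤ 1 - q^(b+1)` by comparison with the geometric sum. For
negative `l` one takes `q = -l`; laziness gives `α (1 - l) ≤ 2α ≤ 1 + l`. -/
lemma abs_pow_mul_one_sub_le {l α : ℝ} (h0 : 0 < α) (h1 : α ≤ 1) (hl : 2 * α - 1 ≤ l)
    (hl1 : l ≤ 1) (b : ℕ) : |l ^ b * (1 - l)| ≤ 1 / (α * (b + 1)) := by
  have geo : ∀ q : ℝ, 0 ≤ q → q ≤ 1 → (b + 1) * q ^ b * (1 - q) ≤ 1 := by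
    intro q hq hq1
    have hs : ((b + 1 : ℕ) : ℝ) * q ^ b ≤ ∑ i ∈ Finset.range (b + 1), q ^ i := by
      rw [← nsmul_eq_mul, ← Finset.card_range (b + 1), ← Finset.sum_const, Finset.card_range]
      exact Finset.sum_le_sum fun i hi =>
        pow_le_pow_of_le_one hq hq1 (Nat.lt_succ_iff.1 (Finset.mem_range.1 hi))
    have hg := geom_sum_mul q (b + 1)
    have hq' : 0 ≤ q ^ (b + 1) := by positivity
    have := mul_le_mul_of_nonneg_right hs (sub_nonneg.2 hq1)
    push_cast at this
    linarith
  have hb : (0 : ℝ) < b + 1 := by positivity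
  rw [le_div_iff₀ (by positivity), abs_mul, abs_pow, abs_of_nonneg (sub_nonneg.2 hl1)]
  rcases le_total 0 l with h | h
  · rw [abs_of_nonneg h]
    have := geo l h hl1
    calc l ^ b * (1 - l) * (α * (b + 1)) = α * ((b + 1) * l ^ b * (1 - l)) := by ring
      _ ≤ 1 * 1 := mul_le_mul h1 this
          (mul_nonneg (by positivity) (sub_nonneg.2 hl1)) (by norm_num)
      _ = 1 := one_mul 1
  · rw [abs_of_nonpos h]
    have := geo (-l) (by linarith) (by linarith)
    have hlb : 0 ≤ (-l) ^ b := by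
      have : 0 ≤ -l := by linarith
      positivity
    calc (-l) ^ b * (1 - l) * (α * (b + 1)) = (b + 1) * (-l) ^ b * (α * (1 - l)) := by ring
      _ ≤ (b + 1) * (-l) ^ b * (1 - (-l)) := by
        refine mul_le_mul_of_nonneg_left ?_ (by positivity)
        nlinarith
      _ ≤ 1 := this

/-- Return probabilities are combinations of eigenvalue powers with squares as weights, and even
powers of numbers in `[-1,1]` decrease. -/
lemma pow_two_mul_antitone (hG : G.Connected) (u : V) :
    Antitone fun a => (W.P ^ (2 * a)) u u := by
  obtain ⟨l, φ, hl, -, hP⟩ := W.exists_spectral hG (α := 0) fun x => W.nonneg x x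
  have hp : 0 < √(W.stat u) := Real.sqrt_pos.2 (W.stat_pos hG u)
  have e : ∀ n, (W.P ^ n) u u = ∑ i, l i ^ n * (φ i u * φ i u) := fun n => by
    have := hP n u u
    rw [mul_comm] at this
    exact mul_right_cancel₀ hp.ne' this
  refine antitone_nat_of_succ_le fun a => ?_
  rw [e, e]
  refine Finset.sum_le_sum fun i _ => mul_le_mul_of_nonneg_right ?_ (mul_self_nonneg _)
  have h2 : l i ^ 2 ≤ 1 := by nlinarith [hl i]
  rw [pow_mul, pow_mul]
  exact pow_le_pow_of_le_one (sq_nonneg _) h2 (Nat.le_succ a)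

/-- Cauchy–Schwarz on `l^(a+b) (1 - l)`: the factor `l^a` goes with `u`, and its squared norm is
`P^(2a)(u,u)`; the factor `l^b (1 - l)` goes with `A`, whose coefficients have squared norm `π(A) ≤
1`. -/
lemma abs_occ_succ_sub_le (hG : G.Connected) {α : ℝ} (h0 : 0 < α) (hα : ∀ x, α ≤ W.P x x)
    (A : Finset V) {u : V} {a : ℕ} {C : ℝ} (hC : 0 ≤ C)
    (ha : (W.P ^ (2 * a)) u u ≤ C ^ 2 * W.stat u)
    (b : ℕ) : |W.occ A (a + b) u - W.occ A (a + b + 1) u| ≤ C / (α * (b + 1)) := by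
  obtain ⟨l, φ, hl, hφ, hP⟩ := W.exists_spectral hG hα
  have h1 : α ≤ 1 := (hα u).trans <| by
    rw [← W.row_sum u]
    exact Finset.single_le_sum (fun y _ => W.nonneg u y) (Finset.mem_univ u)
  have hp : 0 < √(W.stat u) := Real.sqrt_pos.2 (W.stat_pos hG u)
  set β : V → ℝ := fun i => ∑ y ∈ A, φ i y * √(W.stat y) with hβ
  have hocc : ∀ n, √(W.stat u) * W.occ A n u = ∑ i, l i ^ n * φ i u * β i := fun n => by
    simp only [occ, Finset.mul_sum, hP, Finset.sum_mul, hβ]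
    rw [Finset.sum_comm]
    exact Finset.sum_congr rfl fun i _ => Finset.sum_congr rfl fun y _ => by ring
  have hβ1 : ∑ i, β i ^ 2 ≤ 1 := by
    have : ∑ i, β i ^ 2 = ∑ y ∈ A, W.stat y := by
      simp only [hβ, sq, Finset.sum_mul_sum]
      rw [Finset.sum_comm]
      refine Finset.sum_congr rfl fun y hy => ?_
      rw [Finset.sum_comm]
      have : ∀ z, ∑ i, φ i y * √(W.stat y) * (φ i z * √(W.stat z))
          = if y = z then W.stat y else 0 := fun z => by
        have e : ∀ i, φ i y * √(W.stat y) * (φ i z * √(W.stat z))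
            = φ i y * φ i z * (√(W.stat y) * √(W.stat z)) := fun i => by ring
        simp only [e]
        rw [← Finset.sum_mul, hφ]
        split_ifs with h
        · rw [← h, one_mul, Real.mul_self_sqrt (W.stat_nonneg y)]
        · rw [zero_mul]
      simp only [this]
      rw [Finset.sum_ite_eq, if_pos hy]
    rw [this, ← W.stat_sum]
    exact Finset.sum_le_sum_of_subset_of_nonneg (Finset.subset_univ A)
      fun x _ _ => W.stat_nonneg x
  have hφa : ∑ i, (l i ^ a * φ i u) ^ 2 ≤ C ^ 2 * W.stat u := by
    have := hP (2 * a) u u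
    rw [mul_comm] at this
    rw [mul_right_cancel₀ hp.ne' this] at ha
    refine le_trans (le_of_eq ?_) ha
    exact Finset.sum_congr rfl fun i _ => by ring
  set K := 1 / (α * ((b : ℝ) + 1)) with hK
  have hK0 : 0 ≤ K := by positivity
  have hd : ∑ i, (l i ^ b * (1 - l i) * β i) ^ 2 ≤ K ^ 2 := by
    calc _ ≤ ∑ i, K ^ 2 * β i ^ 2 := by
          refine Finset.sum_le_sum fun i _ => ?_
          rw [mul_pow]
          refine mul_le_mul_of_nonneg_right ?_ (sq_nonneg _)
          rw [← sq_abs]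
          exact pow_le_pow_left₀ (abs_nonneg _)
            (abs_pow_mul_one_sub_le h0 h1 (hl i).1 (hl i).2 b) 2
      _ = K ^ 2 * ∑ i, β i ^ 2 := by rw [Finset.mul_sum]
      _ ≤ K ^ 2 * 1 := mul_le_mul_of_nonneg_left hβ1 (sq_nonneg _)
      _ = K ^ 2 := mul_one _
  have hdiff : √(W.stat u) * (W.occ A (a + b) u - W.occ A (a + b + 1) u)
      = ∑ i, (l i ^ a * φ i u) * (l i ^ b * (1 - l i) * β i) := by
    rw [mul_sub, hocc, hocc, ← Finset.sum_sub_distrib]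
    exact Finset.sum_congr rfl fun i _ => by ring
  have hcs := Finset.sum_mul_sq_le_sq_mul_sq Finset.univ (fun i => l i ^ a * φ i u)
    (fun i => l i ^ b * (1 - l i) * β i)
  rw [← hdiff, mul_pow, Real.sq_sqrt (W.stat_nonneg u)] at hcs
  have hfin : W.stat u * (W.occ A (a + b) u - W.occ A (a + b + 1) u) ^ 2
      ≤ W.stat u * (C * K) ^ 2 := by
    refine hcs.trans ((mul_le_mul hφa hd (Finset.sum_nonneg fun _ _ => sq_nonneg _)
      (mul_nonneg (sq_nonneg _) (W.stat_nonneg u))).trans_eq (by ring))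
  have := abs_le_of_sq_le_sq (le_of_mul_le_mul_left hfin (W.stat_pos hG u)) (by positivity)
  refine this.trans_eq ?_
  rw [hK]; ring

/-- Mixing from a point `u` that is quickly hit by the stationary walk. -/
lemma abs_occ_sub_stat_le (hG : G.Connected) {α : ℝ} (h0 : 0 < α) (hα : ∀ x, α ≤ W.P x x)
    (A : Finset V) {u : V} {s a m : ℕ} (hq : ∑ x, W.stat x * W.surv u s x ≤ 1 / 2)
    (hs : s ≤ 2 * a + 1) (hm : 2 * a + s ≤ m) :
    |W.occ A m u - ∑ x ∈ A, W.stat x|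
      ≤ s * (3 / (α * (a + 1))) + ∑ x, W.stat x * W.surv u s x := by
  have ha0 : (0 : ℝ) < a + 1 := by positivity
  -- Each of the `a + 1` even times up to `2a` contributes at least `P^(2a)(u,u)` to the expected
  -- visits, which are at most `2 (s + 2a + 1) π(u) ≤ 8 (a + 1) π(u)`; `8` is rounded up to a
  -- square.
  have hpow : (W.P ^ (2 * a)) u u ≤ 3 ^ 2 * W.stat u := by
    have h1 := W.sum_pow_le (M := 2 * a + 1) hq
    have h2 : ∑ j ∈ Finset.range (a + 1), W.occ {u} (2 * j) u
        ≤ ∑ i ∈ Finset.range (2 * a + 1), W.occ {u} i u := by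
      rw [← Finset.sum_image (f := fun i => W.occ {u} i u) (g := fun j => 2 * j)
        (fun x _ y _ h => by simpa using h)]
      refine Finset.sum_le_sum_of_subset_of_nonneg ?_ fun _ _ _ => W.occ_nonneg _ _ _
      intro i hi
      obtain ⟨j, hj, rfl⟩ := Finset.mem_image.1 hi
      rw [Finset.mem_range] at hj ⊢
      omega
    have h3 : ((a + 1 : ℕ) : ℝ) * (W.P ^ (2 * a)) u u
        ≤ ∑ j ∈ Finset.range (a + 1), W.occ {u} (2 * j) u := by
      rw [← nsmul_eq_mul, ← Finset.card_range (a + 1), ← Finset.sum_const, Finset.card_range]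
      refine Finset.sum_le_sum fun j hj => ?_
      rw [occ_singleton]
      exact W.pow_two_mul_antitone hG u (Nat.lt_succ_iff.1 (Finset.mem_range.1 hj))
    have h4 : ((s + (2 * a + 1) : ℕ) : ℝ) ≤ 4 * (a + 1) := by
      exact_mod_cast (show s + (2 * a + 1) ≤ 4 * (a + 1) by omega)
    have h5 := mul_le_mul_of_nonneg_right h4 (W.stat_nonneg u)
    push_cast at h1 h3 h4 h5
    have h6 : ((a : ℝ) + 1) * (W.P ^ (2 * a)) u u ≤ (a + 1) * (8 * W.stat u) := by linarith
    have := le_of_mul_le_mul_left h6 ha0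
    linarith [W.stat_nonneg u]
  have hstep : ∀ j, 2 * a ≤ j →
      |W.occ A j u - W.occ A (j + 1) u| ≤ 3 / (α * (a + 1)) := by
    intro j hj
    obtain ⟨b, rfl⟩ : ∃ b, j = a + b := ⟨j - a, by omega⟩
    refine (W.abs_occ_succ_sub_le hG h0 hα A (by norm_num) hpow b).trans ?_
    have : (a : ℝ) ≤ b := by exact_mod_cast (show a ≤ b by omega)
    gcongr
  have hwin : ∀ d j, 2 * a ≤ j →
      |W.occ A j u - W.occ A (j + d) u| ≤ d * (3 / (α * (a + 1))) := by
    intro d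
    induction d with
    | zero => intro j _; simp
    | succ d ih =>
      intro j hj
      have h1 := ih j hj
      have h2 := hstep (j + d) (by omega)
      have h3 := abs_sub_le (W.occ A j u) (W.occ A (j + d) u) (W.occ A (j + (d + 1)) u)
      push_cast
      rw [← add_assoc] at h3 ⊢
      linarith
  have hc : 0 ≤ 3 / (α * ((a : ℝ) + 1)) := by positivity
  obtain ⟨M, rfl⟩ : ∃ M, m = M + s := ⟨m - s, by omega⟩
  have hx := W.abs_occ_sub_le (A := A) (u := u) (M := M) (n := s)
    (W.occ_nonneg A (M + s) u) (W.occ_le_one A (M + s) u)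
    (show 0 ≤ s * (3 / (α * ((a : ℝ) + 1))) by positivity) fun j hj => by
      obtain ⟨d, rfl⟩ := Nat.exists_eq_add_of_le hj
      have := hwin d (M + j) (by omega)
      rw [add_assoc] at this
      refine this.trans (mul_le_mul_of_nonneg_right ?_ hc)
      push_cast; linarith [(Nat.cast_nonneg j : (0 : ℝ) ≤ j)]
  -- By stationarity `π(A)` is the average of the occupation probabilities at time `M + s` over the
  -- starting point.
  have e : W.occ A (M + s) u - ∑ x ∈ A, W.stat x
      = ∑ x, W.stat x * (W.occ A (M + s) u - W.occ A (M + s) x) := by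
    simp only [mul_sub, Finset.sum_sub_distrib, sum_stat_mul_occ, ← Finset.sum_mul, W.stat_sum,
      one_mul]
  rw [e]
  refine (Finset.abs_sum_le_sum_abs _ _).trans ?_
  calc _ ≤ ∑ x, W.stat x * (s * (3 / (α * ((a : ℝ) + 1))) + W.surv u s x) := by
        refine Finset.sum_le_sum fun x _ => ?_
        rw [abs_mul, abs_of_nonneg (W.stat_nonneg x), abs_sub_comm]
        exact mul_le_mul_of_nonneg_left (hx x) (W.stat_nonneg x)
    _ = _ := by
        simp only [mul_add, Finset.sum_add_distrib, ← Finset.sum_mul, W.stat_sum, one_mul]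

/-- If `u` is reached within `n` steps, at least `2a + s` steps remain, enough for the estimate from
`u`. -/
lemma mem_mixedTimes (hG : G.Connected) {α : ℝ} (h0 : 0 < α) (hα : ∀ x, α ≤ W.P x x)
    {u : V} {s a n : ℕ} (hq : ∑ x, W.stat x * W.surv u s x ≤ 1 / 2) (hs : s ≤ 2 * a + 1) {ε η : ℝ}
    (hη : ∀ x, W.surv u n x ≤ η)
    (hε : s * (3 / (α * (a + 1))) + ∑ x, W.stat x * W.surv u s x + η ≤ ε) :
    2 * a + s + n ∈ mixedTimes W ε := by
  have : Nonempty V := ⟨u⟩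
  change (⨆ x : V, tvDist ((W.P ^ (2 * a + s + n)) x) W.stat) ≤ ε
  refine ciSup_le fun x => ?_
  unfold tvDist
  refine ciSup_le fun A => ?_
  have hq0 : 0 ≤ ∑ x, W.stat x * W.surv u s x :=
    Finset.sum_nonneg fun x _ => mul_nonneg (W.stat_nonneg x) (W.surv_nonneg _ _ _)
  have h1 : ∑ x ∈ A, W.stat x ≤ 1 := by
    rw [← W.stat_sum]
    exact Finset.sum_le_sum_of_subset_of_nonneg (Finset.subset_univ A)
      fun x _ _ => W.stat_nonneg x
  have := W.abs_occ_sub_le (A := A) (u := u) (n := n) (M := 2 * a + s)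
    (Finset.sum_nonneg fun x _ => W.stat_nonneg x) h1
    (show 0 ≤ s * (3 / (α * ((a : ℝ) + 1))) + ∑ x, W.stat x * W.surv u s x by positivity)
    (fun j _ => W.abs_occ_sub_stat_le hG h0 hα A hq hs (by omega)) x
  exact this.trans (by linarith [hη x])

end GraphWalk

/-! ### Hitting times on path space and their moments -/

lemma lt_hit_iff {V : Type*} (u : V) (w : ℕ → V) (n : ℕ) :
    (n : ℕ∞) < hit {u} w ↔ ∀ i ≤ n, w i ≠ u := by
  constructor
  · intro h i hi hu
    have : hit {u} w ≤ i := sInf_le ⟨i, rfl, zero_le, hu⟩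
    exact absurd (h.trans_le this) (not_lt.2 (by exact_mod_cast hi))
  · intro h
    have h1 : ((n + 1 : ℕ) : ℕ∞) ≤ hit {u} w := by
      refine le_sInf ?_
      rintro t ⟨s, rfl, -, hs⟩
      by_contra hlt
      have : s < n + 1 := by exact_mod_cast not_le.1 hlt
      exact h s (by omega) hs
    exact lt_of_lt_of_le (by exact_mod_cast Nat.lt_succ_self n) h1

lemma measurableSet_avoid {V : Type*} [MeasurableSpace V] [DiscreteMeasurableSpace V]
    (u : V) (n : ℕ) : MeasurableSet {w : ℕ → V | ∀ i ≤ n, w i ≠ u} := by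
  simp only [Set.ofPred_forall]
  exact MeasurableSet.iInter fun i => MeasurableSet.iInter fun _ =>
    (MeasurableSet.of_discrete (s := ({u}ᶜ : Set V))).preimage (measurable_pi_apply i)

lemma measurableSet_lt_hit {V : Type*} [MeasurableSpace V] [DiscreteMeasurableSpace V]
    (u : V) (n : ℕ) :
    MeasurableSet {w : ℕ → V | (n : ℕ∞) < hit {u} w} := by
  simp only [lt_hit_iff]; exact measurableSet_avoid u n

lemma ENat.coe_lt_of_lt_toNat {n : ℕ} {t : ℕ∞} (h : n < t.toNat) : (n : ℕ∞) < t :=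
  lt_of_lt_of_le (by exact_mod_cast h) t.natCast_toNat_le_self

lemma measurable_toNat_hit {V : Type*} [MeasurableSpace V] [DiscreteMeasurableSpace V]
    (u : V) :
    Measurable fun w : ℕ → V => (hit {u} w).toNat := by
  refine measurable_of_Ioi fun n => ?_
  -- `toNat` sends `⊤` to `0`, so paths that never hit `u` have to be removed.
  have : (fun w : ℕ → V => (hit {u} w).toNat) ⁻¹' Set.Ioi n
      = {w | (n : ℕ∞) < hit {u} w} \ ⋂ m : ℕ, {w | (m : ℕ∞) < hit {u} w} := by
    ext w
    simp only [Set.mem_preimage, Set.mem_Ioi, Set.mem_sdiff, Set.mem_ofPred_eq, Set.mem_iInter]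
    constructor
    · intro h
      refine ⟨ENat.coe_lt_of_lt_toNat h, fun h' => ?_⟩
      have ht : hit {u} w = ⊤ := ENat.eq_top_iff_forall_gt.2 h'
      rw [ht] at h
      simp at h
    · rintro ⟨h, h'⟩
      have ht : hit {u} w ≠ ⊤ := fun h0 => h' fun m => by rw [h0]; exact ENat.natCast_lt_top m
      rw [← ENat.natCast_toNat ht] at h
      exact_mod_cast h
  rw [this]
  exact (measurableSet_lt_hit u n).diff (MeasurableSet.iInter fun m => measurableSet_lt_hit u m)

namespace GraphWalk

variable {V : Type*} [Fintype V] [MeasurableSpace V] [DiscreteMeasurableSpace V]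
  {G : SimpleGraph V} (W : GraphWalk G)

instance (x : V) : IsProbabilityMeasure (pathLaw W x) := by
  unfold pathLaw; infer_instance

lemma lintegral_stepKernel (x : V) (f : V → ENNReal) :
    ∫⁻ y, f y ∂(stepKernel W x) = ∑ y, ENNReal.ofReal (W.P x y) * f y := by
  change ∫⁻ y, f y ∂(∑ y, ENNReal.ofReal (W.P x y) • Measure.dirac y : Measure V) = _
  rw [lintegral_finsetSum_measure]
  simp [lintegral_smul_measure]

/-- One step of the Markov property, for the walk killed at `u`. -/
lemma lintegral_avoid_succ (u x : V) (n : ℕ) (f : V → ENNReal) (hf : f u = 0) :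
    ∫⁻ w in {w | ∀ i ≤ n + 1, w i ≠ u}, f (w (n + 1)) ∂(pathLaw W x)
      = ∫⁻ w in {w | ∀ i ≤ n, w i ≠ u}, ∑ y, ENNReal.ofReal (W.P (w n) y) * f y
          ∂(pathLaw W x) := by
  classical
  -- Survival up to time `n` depends only on the history, so the integral disintegrates into a
  -- history and one further step.
  let F : (Finset.Iic n → V) × V → ENNReal := fun p => if ∀ i, p.1 i ≠ u then f p.2 else 0
  let g : (Finset.Iic n → V) → ENNReal := fun p => ∫⁻ y, F (p, y) ∂(historyKernel W n p)
  have hF : Measurable F := Measurable.of_discrete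
  have hg : Measurable g := Measurable.of_discrete
  have hav : ∀ w : ℕ → V, (∀ i : Finset.Iic n, w i ≠ u) ↔ ∀ i ≤ n, w i ≠ u := fun w =>
    ⟨fun h i hi => h ⟨i, Finset.mem_Iic.2 hi⟩, fun h i => h i (Finset.mem_Iic.1 i.2)⟩
  have hF1 : ∀ (w : ℕ → V) y, (∀ i ≤ n, w i ≠ u) → F (Preorder.frestrictLe n w, y) = f y :=
    fun w y h => if_pos ((hav w).2 h)
  have hF0 : ∀ (w : ℕ → V) y, ¬ (∀ i ≤ n, w i ≠ u) → F (Preorder.frestrictLe n w, y) = 0 :=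
    fun w y h => if_neg fun h' => h ((hav w).1 h')
  have hcp := Kernel.partialTraj_compProd_eq_map_traj (X := fun _ : ℕ => V)
    (κ := historyKernel W) (Nat.zero_le n) (x₀ := fun _ => x)
  have hmp := Kernel.traj_map_frestrictLe_apply (X := fun _ : ℕ => V)
    (κ := historyKernel W) 0 n (fun _ => x)
  calc _ = ∫⁻ w, F (Preorder.frestrictLe n w, w (n + 1)) ∂(pathLaw W x) := by
        rw [← lintegral_indicator (measurableSet_avoid u (n + 1))]
        refine lintegral_congr fun w => ?_
        simp only [Set.indicator, Set.mem_ofPred_eq]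
        by_cases h : ∀ i ≤ n, w i ≠ u
        · rw [hF1 w _ h]
          by_cases hu : w (n + 1) = u
          · rw [hu, hf, ite_self]
          · rw [if_pos]
            intro i hi
            rcases Nat.lt_or_ge n i with h' | h'
            · obtain rfl : i = n + 1 := by omega
              exact hu
            · exact h i h'
        · rw [if_neg (fun h' => h fun i hi => h' i (by omega)), hF0 w _ h]
    _ = ∫⁻ p, g p ∂(Kernel.partialTraj (X := fun _ => V) (historyKernel W) 0 n fun _ => x) := by
        rw [← Measure.lintegral_compProd hF, hcp, lintegral_map hF (by fun_prop)]
        rfl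
    _ = ∫⁻ w, g (Preorder.frestrictLe n w) ∂(pathLaw W x) := by
        rw [← hmp, lintegral_map hg (by fun_prop)]
        rfl
    _ = _ := by
        rw [← lintegral_indicator (measurableSet_avoid u n)]
        refine lintegral_congr fun w => ?_
        have hk : historyKernel W n (Preorder.frestrictLe n w) = stepKernel W (w n) := rfl
        simp only [g, hk, lintegral_stepKernel, Set.indicator, Set.mem_ofPred_eq]
        by_cases h : ∀ i ≤ n, w i ≠ u
        · simp only [hF1 w _ h, if_pos h]
        · simp only [hF0 w _ h, if_neg h, mul_zero, Finset.sum_const_zero]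

/-- Markov property at time `n` for the killed walk. Each induction step moves one unit of time from
`j` to `n`, so `n` must stay general. -/
lemma pathLaw_avoid (u x : V) (n j : ℕ) :
    pathLaw W x {w | ∀ i ≤ n + j, w i ≠ u}
      = ∫⁻ w in {w | ∀ i ≤ n, w i ≠ u}, ENNReal.ofReal (W.surv u j (w n)) ∂(pathLaw W x) := by
  induction j generalizing n with
  | zero =>
    rw [add_zero, ← setLIntegral_one]
    refine setLIntegral_congr_fun (measurableSet_avoid u n) fun w hw => ?_
    simp only [W.surv_zero_of_ne (hw n le_rfl), ENNReal.ofReal_one]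
  | succ j ih =>
    rw [show n + (j + 1) = n + 1 + j by ring, ih,
      W.lintegral_avoid_succ u x n (fun y => ENNReal.ofReal (W.surv u j y)) (by simp [surv_self])]
    refine setLIntegral_congr_fun (measurableSet_avoid u n) fun w hw => ?_
    simp only [W.surv_succ_of_ne (hw n le_rfl)]
    rw [ENNReal.ofReal_sum_of_nonneg fun y _ => mul_nonneg (W.nonneg _ _) (W.surv_nonneg _ _ _)]
    exact Finset.sum_congr rfl fun y _ => (ENNReal.ofReal_mul (W.nonneg _ _)).symm

lemma pathLaw_lt_hit (u x : V) (n : ℕ) :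
    pathLaw W x {w | (n : ℕ∞) < hit {u} w} = ENNReal.ofReal (W.surv u n x) := by
  simp only [lt_hit_iff]
  have h := W.pathLaw_avoid u x 0 n
  rw [zero_add] at h
  rw [h, ← lintegral_indicator (measurableSet_avoid u 0)]
  have hm : Measurable ({w : ℕ → V | ∀ i ≤ 0, w i ≠ u}.indicator
      fun w => ENNReal.ofReal (W.surv u n (w 0))) :=
    ((Measurable.of_discrete (f := fun y => ENNReal.ofReal (W.surv u n y))).comp
      (measurable_pi_apply 0)).indicator (measurableSet_avoid u 0)
  unfold pathLaw
  rw [Kernel.lintegral_traj _ hm]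
  have e : ∀ w : ℕ → V, ({w : ℕ → V | ∀ i ≤ 0, w i ≠ u}.indicator
      fun w => ENNReal.ofReal (W.surv u n (w 0)))
        (Function.updateFinset w (Finset.Iic 0) fun _ => x) = ENNReal.ofReal (W.surv u n x) := by
    intro w
    have hw : Function.updateFinset w (Finset.Iic 0) (fun _ => x) 0 = x := by
      simp [Function.updateFinset]
    by_cases hx : x = u
    · subst hx
      simp only [Set.indicator]
      split_ifs
      · rw [hw]
      · simp [surv_self]
    · rw [Set.indicator_of_mem, hw]
      intro i hi
      rw [Nat.le_zero.1 hi, hw]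
      exact hx
  simp only [e]
  simp

/-- Writing a square as a sum of odd numbers bounds the second moment by the series of
`summable_mul_surv`. -/
lemma memLp_hit (hG : G.Connected) (u x : V) :
    MemLp (fun w => ((hit {u} w).toNat : ℝ)) 2 (pathLaw W x) := by
  have hm : Measurable fun w : ℕ → V => ((hit {u} w).toNat : ℝ) :=
    Measurable.of_discrete.comp (measurable_toNat_hit u)
  rw [memLp_two_iff_integrable_sq hm.aestronglyMeasurable]
  refine ⟨(hm.pow_const 2).aestronglyMeasurable, ?_⟩
  have hpt : ∀ w : ℕ → V, ‖((hit {u} w).toNat : ℝ) ^ 2‖ₑ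
      ≤ ∑' n : ℕ, {w | (n : ℕ∞) < hit {u} w}.indicator
        (fun _ => ENNReal.ofReal (2 * n + 1)) w := by
    intro w
    have hsq : ∀ N : ℕ, (N : ℝ) ^ 2 = ∑ n ∈ Finset.range N, (2 * (n : ℝ) + 1) := by
      intro N
      induction N with
      | zero => simp
      | succ N ih => rw [Finset.sum_range_succ, ← ih]; push_cast; ring
    rw [Real.enorm_of_nonneg (by positivity), hsq,
      ENNReal.ofReal_sum_of_nonneg fun n _ => by positivity]
    refine le_trans (Finset.sum_le_sum fun n hn => ?_) (ENNReal.sum_le_tsum _)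
    rw [Set.indicator_of_mem]
    exact ENat.coe_lt_of_lt_toNat (Finset.mem_range.1 hn)
  refine (lintegral_mono hpt).trans_lt ?_
  rw [lintegral_tsum fun n => (measurable_const.indicator (measurableSet_lt_hit u n)).aemeasurable]
  have e : ∀ n : ℕ, ∫⁻ w, {w | (n : ℕ∞) < hit {u} w}.indicator
      (fun _ => ENNReal.ofReal (2 * n + 1)) w ∂(pathLaw W x)
      = ENNReal.ofReal ((2 * n + 1) * W.surv u n x) := fun n => by
    rw [lintegral_indicator_const (measurableSet_lt_hit u n), pathLaw_lt_hit,
      ENNReal.ofReal_mul (by positivity)]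
  simp only [e]
  exact (W.summable_mul_surv hG u x).tsum_ofReal_lt_top

/-- Passing to `toNat` loses the paths with infinite hitting time; these have measure zero because
the tails vanish. -/
lemma surv_le_real_toNat (hG : G.Connected) (u x : V) (n : ℕ) :
    W.surv u n x ≤ (pathLaw W x).real {w | ((n + 1 : ℕ) : ℝ) ≤ ((hit {u} w).toNat : ℝ)} := by
  have htop : (pathLaw W x) {w | hit {u} w = ⊤} = 0 := by
    have hlim : Tendsto (fun m => ENNReal.ofReal (W.surv u m x)) atTop (𝓝 0) := by
      rw [← ENNReal.ofReal_zero]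
      refine ENNReal.tendsto_ofReal (squeeze_zero (fun m => W.surv_nonneg u m x) (fun m => ?_)
        (W.summable_mul_surv hG u x).tendsto_atTop_zero)
      exact le_mul_of_one_le_left (W.surv_nonneg u m x)
        (by linarith [(Nat.cast_nonneg m : (0 : ℝ) ≤ m)])
    refine le_antisymm (ge_of_tendsto' hlim fun m => ?_) (zero_le)
    rw [← pathLaw_lt_hit]
    refine measure_mono fun w (hw : hit {u} w = ⊤) => ?_
    rw [Set.mem_ofPred_eq, hw]
    exact ENat.natCast_lt_top m
  have hsub : {w : ℕ → V | (n : ℕ∞) < hit {u} w} ⊆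
      {w | ((n + 1 : ℕ) : ℝ) ≤ ((hit {u} w).toNat : ℝ)} ∪ {w | hit {u} w = ⊤} := by
    intro w hw
    by_cases ht : hit {u} w = ⊤
    · exact Or.inr ht
    · left
      rw [Set.mem_ofPred_eq, ← ENat.natCast_toNat ht] at hw
      have : n < (hit {u} w).toNat := by exact_mod_cast hw
      exact Nat.cast_le (α := ℝ).2 (Nat.succ_le_of_lt this)
  have h1 := (measure_mono hsub).trans (measure_union_le (μ := pathLaw W x) _ _)
  rw [pathLaw_lt_hit, htop, add_zero] at h1
  exact (ENNReal.ofReal_le_iff_le_toReal (measure_ne_top _ _)).1 h1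

lemma surv_mul_le_meanHit (hG : G.Connected) (u x : V) (n : ℕ) :
    (n + 1) * W.surv u n x ≤ meanHit W x {u} := by
  have h := mul_meas_ge_le_integral_of_nonneg
    (Eventually.of_forall fun w => Nat.cast_nonneg (hit {u} w).toNat)
    ((W.memLp_hit hG u x).integrable one_le_two) ((n + 1 : ℕ) : ℝ)
  refine le_trans ?_ h
  push_cast
  refine mul_le_mul_of_nonneg_left ?_ (by positivity)
  exact_mod_cast W.surv_le_real_toNat hG u x n

lemma surv_le_sdHit_sq_div (hG : G.Connected) (u x : V) {n : ℕ} {a : ℝ} (ha : 0 < a)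
    (hn : meanHit W x {u} + a ≤ n + 1) : W.surv u n x ≤ sdHit W x {u} ^ 2 / a ^ 2 := by
  refine (W.surv_le_real_toNat hG u x n).trans ?_
  have h := meas_ge_le_variance_div_sq (W.memLp_hit hG u x) ha
  rw [sdHit, Real.sq_sqrt (variance_nonneg _ _)]
  refine ENNReal.toReal_le_of_le_ofReal (div_nonneg (variance_nonneg _ _) (sq_nonneg _)) ?_
  refine (measure_mono fun w (hw : ((n + 1 : ℕ) : ℝ) ≤ _) => ?_).trans h
  rw [Set.mem_ofPred_eq]
  refine le_trans ?_ (le_abs_self _)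
  push_cast at hw
  rw [meanHit] at hn
  linarith

lemma meanHit_nonneg (x : V) (U : Set V) : 0 ≤ meanHit W x U :=
  integral_nonneg fun _ => Nat.cast_nonneg _

end GraphWalk

/-! ### The time budget in the bottleneck graph -/

namespace BottleneckGraph

variable {V : Type*} [Fintype V] {G : SimpleGraph V} {W : GraphWalk G} (H : BottleneckGraph G W)

/-- Otherwise `T0` is the single point `0`, which lies in the bottleneck, and `B ∪ S` carries all
the mass. The resulting bound `1 ≤ E_∂D(τ_0)` absorbs rounding errors later. -/
lemma e_ne_o (hmass : H.massBS < 1) : H.e ≠ H.o := by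
  classical
  intro he
  refine hmass.ne ?_
  rw [massBS, ← W.stat_sum]
  refine Finset.sum_congr (Finset.filter_true_of_mem fun x _ => ?_) fun _ _ => rfl
  by_cases hD : x ∈ H.D
  · left
    rcases hD with h | h
    · have h0 := H.e_mem.2 x h
      rw [he, SimpleGraph.dist_self, Nat.le_zero, H.connected.dist_eq_zero_iff] at h0
      rw [← h0]
      exact ⟨H.o_mem.2, by rw [SimpleGraph.dist_self]; exact Nat.zero_le _⟩
    · exact h
  · exact Or.inr hD

/-- A point outside `B ∪ S` lies in `T0`, where `e` is the worst start. -/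
lemma sum_stat_mul_surv_le (n : ℕ) :
    ∑ x, W.stat x * W.surv H.o n x ≤ H.massBS + W.surv H.o n H.e := by
  classical
  have hpt : ∀ x, W.stat x * W.surv H.o n x
      ≤ (if x ∈ H.B ∪ H.S then W.stat x else 0) + W.stat x * W.surv H.o n H.e := by
    intro x
    have h0 := mul_nonneg (W.stat_nonneg x) (W.surv_nonneg H.o n H.e)
    split_ifs with h
    · have := mul_le_mul_of_nonneg_left (W.surv_le_one H.o n x) (W.stat_nonneg x)
      linarith
    · rw [zero_add]
      refine mul_le_mul_of_nonneg_left (H.surv_le_surv_e n ?_) (W.stat_nonneg x)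
      by_contra hT
      refine h ?_
      by_cases hB : x ∈ H.B
      · exact Or.inl hB
      · exact Or.inr fun hD => hD.elim hT hB
  refine (Finset.sum_le_sum fun x _ => hpt x).trans_eq ?_
  rw [Finset.sum_add_distrib, ← Finset.sum_mul, W.stat_sum, one_mul, ← Finset.sum_filter, massBS]

variable [MeasurableSpace V] [DiscreteMeasurableSpace V]

lemma one_le_Ebdry (hmass : H.massBS < 1) : 1 ≤ H.Ebdry := by
  have h := W.surv_mul_le_meanHit H.connected H.o H.e 0
  rw [W.surv_zero_of_ne (H.e_ne_o hmass)] at h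
  norm_num at h
  exact h

lemma surv_mul_le_Ebdry (n : ℕ) {x : V} (hx : x ∈ H.T0) :
    (n + 1) * W.surv H.o n x ≤ H.Ebdry :=
  (mul_le_mul_of_nonneg_left (H.surv_le_surv_e n hx) (by positivity)).trans
    (W.surv_mul_le_meanHit H.connected H.o H.e n)

lemma surv_root_mul_le (i : Fin H.m) (hi : meanHit W (H.tip i) {H.root i} ≤ H.Ebdry) (n : ℕ)
    {x : V} (hx : x ∈ H.T i) : (n + 1) * W.surv (H.root i) n x ≤ H.Ebdry :=
  (mul_le_mul_of_nonneg_left (H.surv_le_surv_tip i n hx) (by positivity)).trans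
    ((W.surv_mul_le_meanHit H.connected (H.root i) (H.tip i) n).trans hi)

/-- From any starting point, `0` is hit soon after the mean hitting time from `c`. -/
lemma surv_add_le_of_mean (hC3' : ∀ i, meanHit W (H.tip i) {H.root i} ≤ H.Ebdry)
    {γ : ℝ} (hγ : 0 < γ) (hsd : 0 < H.sdc) {n₁ n₂ : ℕ} (hn₂ : H.Ec + γ * H.sdc ≤ n₂ + 1) (x : V) :
    W.surv H.o (n₁ + n₂) x ≤ H.Ebdry / (n₁ + 1) + 1 / γ ^ 2 := by
  have hn : (0 : ℝ) < n₁ + 1 := by positivity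
  have hE : 0 ≤ H.Ebdry := W.meanHit_nonneg _ _
  have hE' : 0 ≤ H.Ebdry / (n₁ + 1) := by positivity
  have hγ2 : 0 ≤ 1 / γ ^ 2 := by positivity
  have hc : W.surv H.o n₂ H.c ≤ 1 / γ ^ 2 := by
    refine (W.surv_le_sdHit_sq_div H.connected H.o H.c (mul_pos hγ hsd) hn₂).trans_eq ?_
    rw [sdc] at hsd ⊢
    field_simp [hsd.ne']
  have hcov : x ∈ H.T0 ∪ H.spine ∪ ⋃ i, H.T i := by rw [H.cover]; trivial
  -- From `T0` the first `n₁` steps suffice, from the spine `n₂` steps; from a branch, `n₁` steps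
  -- lead to the root and `n₂` more to `0`.
  rcases hcov with (h0 | hs) | ht
  · have h1 : W.surv H.o n₁ x ≤ H.Ebdry / (n₁ + 1) := by
      rw [le_div_iff₀ hn, mul_comm]; exact H.surv_mul_le_Ebdry n₁ h0
    have h2 := W.surv_antitone H.o x (Nat.le_add_right n₁ n₂)
    simp only at h2
    linarith
  · have h1 := H.surv_le_surv_c n₂ hs
    have h2 := W.surv_antitone H.o x (Nat.le_add_left n₂ n₁)
    simp only at h2
    linarith
  · obtain ⟨i, hi⟩ := Set.mem_iUnion.1 ht
    have h1 : W.surv (H.root i) n₁ x ≤ H.Ebdry / (n₁ + 1) := by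
      rw [le_div_iff₀ hn, mul_comm]; exact H.surv_root_mul_le i (hC3' i) n₁ hi
    have h2 := H.surv_le_surv_c n₂ (H.root_mem i).2
    linarith [W.surv_add_le H.o (H.root i) n₁ n₂ x]

variable [DecidableEq V]

/-- With `t = γ √Var_c(τ_0) / A`, mixing from `0` takes `2a + s` steps with `a ≈ t/8` and `s ≈ K E`,
leaving a branch takes `b ≈ t/4`, and the remaining `n` steps run along the spine. -/
lemma floor_mem_mixedTimes {α A γ K κ ε : ℝ} (h0 : 0 < α) (hα : ∀ x, α ≤ W.P x x)
    (hA : 0 < A) (hA1 : A ≤ 1) (hγ : 0 < γ) (hK : 0 < K) (hκ : 0 < κ) (hKκ : (K + 2) * κ ≤ 1 / 8)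
    (hC3' : ∀ i, meanHit W (H.tip i) {H.root i} ≤ H.Ebdry)
    (hE : H.Ebdry ≤ κ * (γ * H.sdc / A)) (hmass : H.massBS + 1 / K ≤ 1 / 2)
    (hε : 24 * (K + 1) * κ / α + (H.massBS + 1 / K) + (4 * κ + 16 / γ ^ 2) ≤ ε) :
    ⌊(H.Ec + γ * H.sdc) / A⌋₊ ∈ mixedTimes W ε := by
  have hKi : 0 < 1 / K := by positivity
  have hE1 : 1 ≤ H.Ebdry := H.one_le_Ebdry (by linarith)
  have hEc : 0 ≤ H.Ec := W.meanHit_nonneg _ _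
  set E := H.Ebdry
  set t := γ * H.sdc / A with ht_def
  have ht : 0 < t := pos_of_mul_pos_right (by linarith : 0 < κ * t) hκ.le
  have hγsd : γ * H.sdc = t * A := by rw [ht_def]; field_simp
  have hsd : 0 < H.sdc := pos_of_mul_pos_right (by rw [hγsd]; positivity) hγ.le
  have hγt : γ * H.sdc ≤ t := by rw [hγsd]; exact mul_le_of_le_one_right ht.le hA1
  have hT : H.Ec + t ≤ (H.Ec + γ * H.sdc) / A := by
    rw [add_div]
    have : H.Ec ≤ H.Ec / A := by
      rw [le_div_iff₀ hA]; exact mul_le_of_le_one_right hEc hA1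
    linarith
  set T := ⌊(H.Ec + γ * H.sdc) / A⌋₊
  have hTlt : H.Ec + t < T + 1 := hT.trans_lt (Nat.lt_floor_add_one _)
  obtain ⟨s, hs_def⟩ : ∃ s, s = ⌈K * E⌉₊ := ⟨_, rfl⟩
  have hs1 : K * E ≤ s := hs_def ▸ Nat.le_ceil _
  have hs2 : (s : ℝ) < K * E + 1 := hs_def ▸ Nat.ceil_lt_add_one (by positivity)
  have hKE : (K + 2) * E ≤ t / 8 := by
    calc (K + 2) * E ≤ (K + 2) * (κ * t) := mul_le_mul_of_nonneg_left hE (by linarith)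
      _ = (K + 2) * κ * t := by ring
      _ ≤ 1 / 8 * t := mul_le_mul_of_nonneg_right hKκ ht.le
      _ = t / 8 := by ring
  -- `s + 1 < K E + 2 ≤ (K + 2) E`, since `E ≥ 1`.
  have hs3 : (s : ℝ) + 1 ≤ t / 8 := by nlinarith
  obtain ⟨a, ha_def⟩ : ∃ a, a = ⌊t / 8⌋₊ := ⟨_, rfl⟩
  have ha1 : (a : ℝ) ≤ t / 8 := ha_def ▸ Nat.floor_le (by positivity)
  have ha2 : t / 8 < a + 1 := ha_def ▸ Nat.lt_floor_add_one _
  obtain ⟨b, hb_def⟩ : ∃ b, b = ⌊t / 4⌋₊ := ⟨_, rfl⟩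
  have hb1 : (b : ℝ) ≤ t / 4 := hb_def ▸ Nat.floor_le (by positivity)
  have hb2 : t / 4 < b + 1 := hb_def ▸ Nat.lt_floor_add_one _
  have hsa : s ≤ 2 * a + 1 := by
    have : (s : ℝ) < a + 1 := by linarith
    have : s < a + 1 := by exact_mod_cast this
    omega
  obtain ⟨n, hn⟩ : ∃ n, T = 2 * a + s + (b + n) := by
    have : ((2 * a + s + b : ℕ) : ℝ) < ((T + 1 : ℕ) : ℝ) := by push_cast; linarith
    have : 2 * a + s + b < T + 1 := by exact_mod_cast this
    exact ⟨T - (2 * a + s + b), by omega⟩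
  -- At most `5t/8` has been spent, and the remaining `3t/8` exceeds `γ √Var_c(τ_0) / 4` because `A
  -- ≤ 1`. Chebyshev with `γ/4` yields the error `16 / γ²`.
  have hn1 : H.Ec + γ / 4 * H.sdc ≤ n + 1 := by
    have : (T : ℝ) = 2 * a + s + (b + n) := by exact_mod_cast hn
    linarith
  have hq : ∑ x, W.stat x * W.surv H.o s x ≤ H.massBS + 1 / K := by
    refine (H.sum_stat_mul_surv_le s).trans (add_le_add le_rfl ?_)
    have h1 := H.surv_mul_le_Ebdry s H.e_mem.1
    have h2 := mul_le_mul_of_nonneg_right (hs1.trans (le_add_of_nonneg_right zero_le_one))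
      (W.surv_nonneg H.o s H.e)
    rw [le_div_iff₀ hK]
    have h3 : E * (W.surv H.o s H.e * K) ≤ E * 1 := by
      rw [mul_one]
      refine le_trans (le_of_eq ?_) (h2.trans h1)
      ring
    exact le_of_mul_le_mul_left h3 (by linarith)
  have hη : ∀ x, W.surv H.o (b + n) x ≤ 4 * κ + 16 / γ ^ 2 := fun x => by
    refine (H.surv_add_le_of_mean hC3' (show 0 < γ / 4 by positivity) hsd hn1 x).trans
      (add_le_add ?_ (le_of_eq ?_))
    · rw [div_le_iff₀ (by positivity)]
      refine hE.trans ?_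
      nlinarith
    · field_simp; norm_num
  have hstep : (s : ℝ) * (3 / (α * (a + 1))) ≤ 24 * (K + 1) * κ / α := by
    rw [← mul_div_assoc, div_le_div_iff₀ (by positivity) h0]
    have h1 : (s : ℝ) ≤ (K + 1) * (κ * t) := by
      refine le_trans ?_ (mul_le_mul_of_nonneg_left hE (by linarith))
      linarith
    have h2 : (K + 1) * κ * t ≤ (K + 1) * κ * (8 * (a + 1)) :=
      mul_le_mul_of_nonneg_left (by linarith) (by positivity)
    have h3 : (s : ℝ) * α ≤ (K + 1) * κ * (8 * (a + 1)) * α :=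
      mul_le_mul_of_nonneg_right (by linarith) h0.le
    linarith
  rw [hn]
  exact W.mem_mixedTimes H.connected h0 hα (hq.trans hmass) hsa hη (by linarith)

end BottleneckGraph

theorem mainTheorem7
    {V : ℕ → Type*} [∀ k, Fintype (V k)] [∀ k, DecidableEq (V k)]
    [∀ k, MeasurableSpace (V k)] [∀ k, DiscreteMeasurableSpace (V k)]
    (G : ∀ k, SimpleGraph (V k)) (W : ∀ k, GraphWalk (G k))
    (H : ∀ k, BottleneckGraph (G k) (W k))
    (α : ℝ) (hα : 0 < α) (hlazy : ∀ k x, α ≤ (W k).P x x)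
    (A γ δ : ℕ → ℝ) (hA : ∀ k, 0 < A k) (hA1 : ∀ k, A k ≤ 1)
    (hγ : Tendsto γ atTop atTop) (hδ : ∀ k, 0 < δ k)
    -- the bottleneck and S carry vanishing stationary mass
    (hC1 : Tendsto (fun k => (H k).massBS) atTop (𝓝 0))
    -- number of returns to T_0 before hitting z
    (h : ℕ → ℝ) (h_pos : ∀ a, 0 < h a) (h_mono : Monotone h)
    (hC2 : ∀ k, (H k).probLLe (H k).z ≤ 1 / h (H k).z)
    -- traversing T_0 outwards, or a branch, takes no longer on average than returning from ∂D
    (hC3 : ∀ k, meanHit (W k) (H k).o (H k).bdry ≤ (H k).Ebdry)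
    (hC3' : ∀ k i, meanHit (W k) ((H k).tip i) {(H k).root i} ≤ (H k).Ebdry)
    -- the two domination conditions
    (hHa : (fun k => γ k * (H k).sdc) =o[atTop] fun k => (H k).Ec)
    (hHb : (fun k => (H k).Ebdry + (H k).meanL * ((H k).meanLambda + (H k).meanTheta))
      =o[atTop] fun k => γ k * (H k).sdc / A k)
    -- comparison of the hitting times of 0 from ∂D and from c
    (hH2 : ∀ k, (H k).Ebdry + δ k * (H k).sdbdry ≤ ((H k).Ec + γ k / 2 * (H k).sdc) / A k)
    (ε : ℝ) (hε : 0 < ε) (hε1 : ε < 1) :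
    ∀ᶠ k in atTop, (mixedTimes (W k) ε).Nonempty ∧
      (tmix (W k) ε : ℝ) ≤ ((H k).Ec + γ k * (H k).sdc) / A k := by
  -- The total error has five terms: window variation, mass of `B ∪ S`, `1/K`, `4κ` and `16/γ²`.
  -- Each is made at most `ε/8`; the first entry of the minimum defining `κ` secures the time
  -- budget.
  obtain ⟨K, hK⟩ : ∃ K, K = 8 / ε := ⟨_, rfl⟩
  have hK0 : 0 < K := by rw [hK]; positivity
  have hKi : 1 / K = ε / 8 := by rw [hK]; field_simp
  obtain ⟨κ, hκ⟩ : ∃ κ, κ = min (1 / (8 * (K + 2))) (min (ε * α / (192 * (K + 1))) (ε / 32)) :=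
    ⟨_, rfl⟩
  have hκ0 : 0 < κ := by rw [hκ]; positivity
  have hκ1 : κ ≤ 1 / (8 * (K + 2)) := hκ ▸ min_le_left _ _
  have hκ2 : κ ≤ ε * α / (192 * (K + 1)) := hκ ▸ (min_le_right _ _).trans (min_le_left _ _)
  have hκ3 : κ ≤ ε / 32 := hκ ▸ (min_le_right _ _).trans (min_le_right _ _)
  rw [le_div_iff₀ (by positivity)] at hκ1 hκ2
  filter_upwards [hHb.bound hκ0, hγ.eventually_ge_atTop (128 / ε),
    hC1.eventually_le_const (show (0 : ℝ) < ε / 8 by positivity)] with k hb hg hm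
  have hg1 : 1 ≤ 128 / ε := by rw [le_div_iff₀ hε]; linarith
  have hg0 : 0 < γ k := by linarith
  have hsd : 0 ≤ (H k).sdc := Real.sqrt_nonneg _
  have hE : (H k).Ebdry ≤ κ * (γ k * (H k).sdc / A k) := by
    have ht : 0 ≤ γ k * (H k).sdc / A k :=
      div_nonneg (mul_nonneg hg0.le hsd) (hA k).le
    rw [Real.norm_of_nonneg ht] at hb
    refine le_trans ?_ ((le_abs_self _).trans hb)
    have hL : 0 ≤ (H k).meanL := integral_nonneg fun _ => Nat.cast_nonneg _
    have hl : 0 ≤ (H k).meanLambda := integral_nonneg fun _ => Nat.cast_nonneg _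
    have hth : 0 ≤ (H k).meanTheta := integral_nonneg fun _ => Nat.cast_nonneg _
    exact le_add_of_nonneg_right (mul_nonneg hL (add_nonneg hl hth))
  have hγ16 : 16 / γ k ^ 2 ≤ ε / 8 := by
    rw [div_le_iff₀ (by positivity)]
    rw [div_le_iff₀ hε] at hg
    nlinarith
  have hκα : 24 * (K + 1) * κ / α ≤ ε / 8 := by
    rw [div_le_iff₀ hα]; linarith
  have hmem := (H k).floor_mem_mixedTimes hα (hlazy k) (hA k) (hA1 k) hg0 hK0 hκ0 (ε := ε)
    (by linarith) (hC3' k) hE (by rw [hKi]; linarith) (by rw [hKi]; linarith)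
  refine ⟨⟨_, hmem⟩, (Nat.cast_le.2 (Nat.sInf_le hmem)).trans (Nat.floor_le ?_)⟩
  have hEc : 0 ≤ (H k).Ec := (W k).meanHit_nonneg _ _
  exact div_nonneg (add_nonneg hEc (mul_nonneg hg0.le hsd)) (hA k).le
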